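/- Let $M$ be a smooth manifold of dimension $m$ with a volume form $s\in\Omega^{m}(M)$ (a nowhere vanishing top-degree form), and let $A\to M$ be a smooth real vector bundle of rank $n$ with dual $A^*$. Let $(A,[\cdot,\cdot],\rho)$ and $(A^*,[\cdot,\cdot]_*,\rho_*)$ be Lie algebroids such that $(A,A^*)$ is a Lie bialgebroid, i.e. the Lie algebroid differential $d_*$ of $A^*$ is a derivation of the Gerstenhaber algebra $(\Gamma(\wedge^\bullet A),\wedge,[\cdot,\cdot])$: $$d_*[u,v]=[d_*u,v]+(-1)^{k-1}[u,d_*v]\qquad\text{for all }u\in\Gamma(\wedge^kA),\ v\in\Gamma(\wedge^lA).$$ Assume that there is a nowhere vanishing section $\Omega\in\Gamma(\wedge^nA^*)$, and let $V\in\Gamma(\wedge^nA)$ be its dual, $\langle\Omega,V\rangle=1$. For $u\in\Gamma(A)$ let $L_uV=[u,V]$, and for $\theta\in\Gamma(A^*)$ let $L_\theta\Omega=[\theta,\Omega]_*$. Let $X_0\in\Gamma(A)$ and $\xi_0\in\Gamma(A^*)$ be the modular cocycles, defined by $$(L_\theta\Omega)\otimes s+\Omega\otimes L_{\rho_*(\theta)}s=\langle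 X_0,\theta\rangle\,\Omega\otimes s\quad\text{for all }\theta\in\Gamma(A^*),$$ $$(L_{\rho(u)}s)\otimes V+s\otimes L_uV=\langle\xi_0,u\rangle\,s\otimes V\quad\text{for all }u\in\Gamma(A).$$ Then the bundle map $\pi^\sharp=\rho\circ(\rho_*)^*:T^*M\to TM$ is that of a Poisson bivector $\pi$ on $M$, and the modular vector field of $(M,\pi)$ with respect to $s$, i.e. the unique vector field $X_s$ such that $L_{\pi^\sharp(df)}s=X_s(f)\,s$ for all $f\in C^\infty(M)$, is $$X_s=\tfrac12\big(\rho_*(\xi_0)-\rho(X_0)\big).$$ -/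

import Mathlib

open Bundle VectorField
open scoped Manifold ContDiff

noncomputable section

/-! ## Algebra of cochains

`R` is the algebra of smooth functions, `N` and `N'` are the spaces of sections of a vector bundle
and of its dual, `pair θ X = ⟨θ, X⟩`, `br` is the bracket of a Lie algebroid structure on the first
bundle, and `act X f = ρ(X) f`, with `ρ` the anchor. A `k`-cochain on `N` is a function
`(Fin k → N) → R`; the alternating `C^∞`-multilinear ones are the sections of the `k`-th exterior
power of the bundle dual to the one of which `N` is the space of sections. -/

namespace Cochain

variable {R N N' : Type*} [CommRing R] [Algebra ℝ R] [AddCommGroup N] [AddCommGroup N']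

/-- The Lie algebroid (Chevalley-Eilenberg) differential
`(dα)(X₀,…,Xₖ) = ∑ⱼ (-1)ʲ ρ(Xⱼ) α(X₀,…,X̂ⱼ,…,Xₖ) + ∑_{i<j} (-1)^{i+j} α([Xᵢ,Xⱼ],X₀,…,X̂ᵢ,…,X̂ⱼ,…,Xₖ)`.
In the second sum the argument `[Xᵢ,Xⱼ]` is written in place of `Xᵢ`; for alternating `α`, moving it
to the front produces the sign `(-1)ⁱ`. -/
def d (act : N → R → R) (br : N → N → N) {k : ℕ} (α : (Fin k → N) → R) :
    (Fin (k + 1) → N) → R := fun X ↦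
  ∑ j : Fin (k + 1), (-1 : R) ^ (j : ℕ) * act (X j) (α fun i ↦ X (j.succAbove i)) +
    ∑ j : Fin (k + 1), ∑ i : Fin k,
      if i.castSucc < j then
        (-1 : R) ^ (j : ℕ) *
          α (Function.update (fun l ↦ X (j.succAbove l)) i (br (X i.castSucc) (X j)))
      else 0

/-- The Lie derivative of a form: `(L_X α)(Y₁,…,Yₖ) = ρ(X) α(Y₁,…,Yₖ) - ∑ᵢ α(Y₁,…,[X,Yᵢ],…,Yₖ)`. -/
def lieForm (act : N → R → R) (br : N → N → N) {k : ℕ} (X : N) (α : (Fin k → N) → R) :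
    (Fin k → N) → R := fun Y ↦
  act X (α Y) - ∑ i, α (Function.update Y i (br X (Y i)))

open Classical in
/-- The section `X` with `⟨θ, X⟩ = φ θ` for all `θ`. For sections of a finite rank vector bundle and
of its dual it exists and is unique as soon as `φ` is `C^∞`-linear (and likewise for vectors of a
finite-dimensional space and a linear `φ`), which is the case wherever it is applied below to
alternating `C^∞`-multilinear cochains; the value `0` is a convention for the remaining `φ`. -/
def representer (pair : N' → N → R) (φ : N' → R) : N :=
  if h : ∃ X, ∀ θ, pair θ X = φ θ then h.choose else 0

/-- The Lie derivative of a section of the dual bundle, determined by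
`⟨L_X θ, Y⟩ = ρ(X)⟨θ, Y⟩ - ⟨θ, [X, Y]⟩`. -/
def lieDual (act : N → R → R) (br : N → N → N) (pair : N' → N → R) (X : N) (θ : N') : N' :=
  representer (fun Y η ↦ pair η Y) fun Y ↦ act X (pair θ Y) - pair θ (br X Y)

/-- The Lie derivative `L_X P = [X, P]` of a section `P` of the `k`-th exterior power of the bundle
that carries the Lie algebroid structure, `P` being regarded as a form on the dual bundle:
`(L_X P)(θ₁,…,θₖ) = ρ(X) P(θ₁,…,θₖ) - ∑ᵢ P(θ₁,…,L_X θᵢ,…,θₖ)`. -/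
def lieMulti (act : N → R → R) (br : N → N → N) (pair : N' → N → R) {k : ℕ} (X : N)
    (P : (Fin k → N') → R) : (Fin k → N') → R := fun θ ↦
  act X (P θ) - ∑ i, P (Function.update θ i (lieDual act br pair X (θ i)))

/-- The section `P(·, θ₁, …, θₚ)`. -/
def sharp (pair : N' → N → R) {p : ℕ} (P : (Fin (p + 1) → N') → R) (θ : Fin p → N') : N :=
  representer pair fun η ↦ P (Fin.cons η θ)

/-- The `j`-th entry of a tuple (counted from `0`). -/
def entry {n : ℕ} (θ : Fin n → N') (j : ℕ) : N' := if h : j < n then θ ⟨j, h⟩ else 0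

/-- The `r` consecutive entries `θ_a, …, θ_{a+r-1}` of a tuple. -/
def slice {n : ℕ} (θ : Fin n → N') (a r : ℕ) : Fin r → N' := fun i ↦ entry θ (a + i)

/-- The antisymmetrization of `ρ(P(·, θ₁, …, θₚ)) Q(θ_{p+1}, …, θ_{p+l})`, i.e. the signed sum over
the `(p, l)`-shuffles; here `n = p + l`. -/
def derivTerm (act : N → R → R) (pair : N' → N → R) {p l : ℕ} (n : ℕ)
    (P : (Fin (p + 1) → N') → R) (Q : (Fin l → N') → R) : (Fin n → N') → R := fun θ ↦
  ∑ σ : Equiv.Perm (Fin n), (((Equiv.Perm.sign σ : ℤ) : ℝ) / (p.factorial * l.factorial)) •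
    act (sharp pair P (slice (θ ∘ σ) 0 p)) (Q (slice (θ ∘ σ) p l))

/-- The differential of a section `θ` of the dual bundle, evaluated on two sections. -/
def dTwo (act : N → R → R) (br : N → N → N) (pair : N' → N → R) (θ : N') (X Y : N) : R :=
  act X (pair θ Y) - act Y (pair θ X) - pair θ (br X Y)

/-- The antisymmetrization of `(dθ₀)(P(·, θ₁, …, θₚ), Q(·, θ_{p+1}, …, θ_{p+q}))`, i.e. the signed
sum over the `(1, p, q)`-shuffles; here `n = p + q + 1`. -/
def contractTerm (act : N → R → R) (br : N → N → N) (pair : N' → N → R) {p q : ℕ} (n : ℕ)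
    (P : (Fin (p + 1) → N') → R) (Q : (Fin (q + 1) → N') → R) : (Fin n → N') → R := fun θ ↦
  ∑ σ : Equiv.Perm (Fin n), (((Equiv.Perm.sign σ : ℤ) : ℝ) / (p.factorial * q.factorial)) •
    dTwo act br pair (entry (θ ∘ σ) 0) (sharp pair P (slice (θ ∘ σ) 1 p))
      (sharp pair Q (slice (θ ∘ σ) (1 + p) q))

/-- The Gerstenhaber (Schouten) bracket `[P, Q]` of a `k`-vector `P` and an `l`-vector `Q` of a Lie
algebroid, as an `n`-vector with `n = k + l - 1`. It is the biadditive extension of `[X, Y]`,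
`[X, f] = ρ(X) f`, `[f, g] = 0` with
`[X₁∧⋯∧Xₖ, Y₁∧⋯∧Yₗ] = ∑ (-1)^{i+j} [Xᵢ,Yⱼ]∧X₁∧⋯X̂ᵢ⋯∧Xₖ∧Y₁∧⋯Ŷⱼ⋯∧Yₗ` and
`[P, f] = (-1)^{k-1} P(·, …, ·)` contracted in its first argument with `df`, `[f, Q] = -ι_{df} Q`,
written in closed form by means of
`⟨θ, [X, Y]⟩ = ρ(X)⟨θ, Y⟩ - ρ(Y)⟨θ, X⟩ - dθ(X, Y)`. -/
def schouten (act : N → R → R) (br : N → N → N) (pair : N' → N → R) (n : ℕ) :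
    {k l : ℕ} → ((Fin k → N') → R) → ((Fin l → N') → R) → ((Fin n → N') → R)
  | 0, 0, _, _ => 0
  | p + 1, 0, P, Q => (-1 : R) ^ p • derivTerm act pair n P Q
  | 0, _ + 1, P, Q => -derivTerm act pair n Q P
  | p + 1, q + 1, P, Q =>
      (-1 : R) ^ p • derivTerm act pair n P Q - (-1 : R) ^ (q * (p + 1)) • derivTerm act pair n Q P -
        contractTerm act br pair n P Q

end Cochain

/-! ## Functions, vector fields and forms on a manifold -/

section Manifold

variable (m : ℕ) (M : Type*) [TopologicalSpace M] [ChartedSpace (EuclideanSpace ℝ (Fin m)) M]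

/-- The algebra `C^∞(M)`. -/
abbrev SmoothFun : Type _ := C^∞⟮𝓡 m, M; 𝓘(ℝ, ℝ), ℝ⟯

variable [IsManifold (𝓡 m) ∞ M]

/-- Smooth vector fields on `M`. -/
abbrev VectorFields : Type _ :=
  Cₛ^∞⟮𝓡 m; EuclideanSpace ℝ (Fin m), fun x : M ↦ TangentSpace (𝓡 m) x⟯

/-- Smooth sections of the cotangent bundle `T*M`. -/
abbrev OneForms : Type _ :=
  Cₛ^∞⟮𝓡 m; EuclideanSpace ℝ (Fin m) →L[ℝ] ℝ, fun x : M ↦ TangentSpace (𝓡 m) x →L[ℝ] ℝ⟯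

variable {m M}

/-- The de Rham differential `df` of a function. -/
def differential (f : SmoothFun m M) : OneForms m M where
  toFun x := mfderiv (𝓡 m) 𝓘(ℝ, ℝ) f x
  contMDiff_toFun x := by
    rw [contMDiffAt_hom_bundle]
    refine ⟨contMDiffAt_id, ?_⟩
    have := (f.contMDiff x).mfderiv_const (m := ∞) (by simp)
    refine this.congr_of_eventuallyEq (Filter.Eventually.of_forall fun y ↦ ?_)
    ext v
    simp [inTangentCoordinates, ContinuousLinearMap.inCoordinates]
    rfl

/-- The derivative `X(f)` of a function along a vector field. -/
def VectorFields.act (X : VectorFields m M) (f : SmoothFun m M) : SmoothFun m M where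
  val x := mfderiv (𝓡 m) 𝓘(ℝ, ℝ) f x (X x)
  property x := by
    have := (differential f).contMDiff.clm_bundle_apply X.contMDiff x
    rw [contMDiffAt_section] at this
    exact this

/-- The Lie bracket of vector fields. -/
def VectorFields.bracket (X Y : VectorFields m M) : VectorFields m M where
  toFun := mlieBracket (𝓡 m) X Y
  contMDiff_toFun x := by
    have : IsManifold (𝓡 m) (minSmoothness ℝ 2) M := by
      rw [minSmoothness_of_isRCLikeNormedField]
      exact IsManifold.of_le (n := ∞) (WithTop.coe_le_coe.2 le_top)
    have : IsManifold (𝓡 m) (((⊤ : ℕ∞) : WithTop ℕ∞) + 1) M := ‹IsManifold (𝓡 m) ∞ M›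
    exact ContMDiffAt.mlieBracket_vectorField (m := ⊤) (n := ⊤) (X.contMDiff x) (Y.contMDiff x)
      (by simp)

end Manifold

/-! ## Vector bundles and Lie algebroids -/

section Bundle

variable (m : ℕ) {M : Type*} [TopologicalSpace M] [ChartedSpace (EuclideanSpace ℝ (Fin m)) M]
  (F : Type*) [NormedAddCommGroup F] [NormedSpace ℝ F]
  (E : M → Type*) [∀ x, AddCommGroup (E x)] [∀ x, Module ℝ (E x)] [∀ x, TopologicalSpace (E x)]
  [TopologicalSpace (TotalSpace F E)] [FiberBundle F E]

/-- Smooth sections of the `k`-th exterior power of the dual bundle `E*`: smooth families of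
alternating `k`-linear forms on the fibres of `E`. Applied to `E = A*`, these are the smooth sections
of the `k`-th exterior power of `A`. -/
structure FormField (k : ℕ) where
  toFun : ∀ x, E x [⋀^Fin k]→ₗ[ℝ] ℝ
  smooth : ∀ X : Fin k → Cₛ^∞⟮𝓡 m; F, E⟯,
    ContMDiff (𝓡 m) 𝓘(ℝ, ℝ) ∞ fun x ↦ toFun x fun i ↦ X i x

variable {m F E} in
/-- The function `w(X₁, …, Xₖ)`. -/
def FormField.eval {k : ℕ} (w : FormField m F E k) (X : Fin k → Cₛ^∞⟮𝓡 m; F, E⟯) :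
    SmoothFun m M :=
  ⟨fun x ↦ w.toFun x fun i ↦ X i x, w.smooth X⟩

variable [VectorBundle ℝ F E] [IsManifold (𝓡 m) ∞ M]

variable {m F E} in
/-- The product `f X` of a function and a section. -/
def mulSection (f : SmoothFun m M) (X : Cₛ^∞⟮𝓡 m; F, E⟯) : Cₛ^∞⟮𝓡 m; F, E⟯ :=
  ⟨fun x ↦ f x • X x, f.contMDiff.smul_section X.contMDiff⟩

/-- A Lie algebroid structure on the vector bundle `E` (with typical fibre `F`) over `M`: the anchor
is a smooth bundle map `E → TM`, i.e. a smooth section of `Hom(E, TM)`. -/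
structure LieAlgebroid where
  anchor : Cₛ^∞⟮𝓡 m; F →L[ℝ] EuclideanSpace ℝ (Fin m), fun x ↦ E x →L[ℝ] TangentSpace (𝓡 m) x⟯
  bracket : Cₛ^∞⟮𝓡 m; F, E⟯ →ₗ[ℝ] Cₛ^∞⟮𝓡 m; F, E⟯ →ₗ[ℝ] Cₛ^∞⟮𝓡 m; F, E⟯
  bracket_self : ∀ X, bracket X X = 0
  jacobi : ∀ X Y Z, bracket X (bracket Y Z) = bracket (bracket X Y) Z + bracket Y (bracket X Z)
  anchor_bracket : ∀ X Y x, anchor x (bracket X Y x) =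
    mlieBracket (𝓡 m) (fun y ↦ anchor y (X y)) (fun y ↦ anchor y (Y y)) x
  leibniz : ∀ X Y (f : SmoothFun m M) x, bracket X (mulSection f Y) x =
    (show ℝ from mfderiv (𝓡 m) 𝓘(ℝ, ℝ) f x (anchor x (X x))) • Y x + f x • bracket X Y x

variable {m F E}

/-- The vector field `ρ(X)`. -/
def LieAlgebroid.rho (L : LieAlgebroid m F E) (X : Cₛ^∞⟮𝓡 m; F, E⟯) : VectorFields m M :=
  ⟨fun x ↦ L.anchor x (X x), L.anchor.contMDiff.clm_bundle_apply X.contMDiff⟩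

/-- The function `ρ(X) f`. -/
def LieAlgebroid.act (L : LieAlgebroid m F E) (X : Cₛ^∞⟮𝓡 m; F, E⟯) (f : SmoothFun m M) :
    SmoothFun m M :=
  (L.rho X).act f

/-- The bracket of sections as a function of two variables. -/
def LieAlgebroid.br (L : LieAlgebroid m F E) (X Y : Cₛ^∞⟮𝓡 m; F, E⟯) : Cₛ^∞⟮𝓡 m; F, E⟯ :=
  L.bracket X Y

/-- The duality pairing `⟨θ, X⟩` of a section of `E*` and a section of `E`. -/
def pairing (θ : Cₛ^∞⟮𝓡 m; F →L[ℝ] ℝ, fun x ↦ E x →L[ℝ] ℝ⟯) (X : Cₛ^∞⟮𝓡 m; F, E⟯) :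
    SmoothFun m M where
  val x := θ x (X x)
  property x := by
    have := θ.contMDiff.clm_bundle_apply (E₂ := fun _ ↦ ℝ) X.contMDiff x
    rw [contMDiffAt_section] at this
    exact this

/-- The duality pairing with the arguments exchanged. -/
def pairing' (X : Cₛ^∞⟮𝓡 m; F, E⟯) (θ : Cₛ^∞⟮𝓡 m; F →L[ℝ] ℝ, fun x ↦ E x →L[ℝ] ℝ⟯) :
    SmoothFun m M :=
  pairing θ X

end Bundle

/-! ## Lie bialgebroids and modular vector fields -/

section Bialgebroid

variable {m : ℕ} {M : Type*} [TopologicalSpace M] [ChartedSpace (EuclideanSpace ℝ (Fin m)) M]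
  [IsManifold (𝓡 m) ∞ M]
  {F : Type*} [NormedAddCommGroup F] [NormedSpace ℝ F]
  {A : M → Type*} [∀ x, AddCommGroup (A x)] [∀ x, Module ℝ (A x)] [∀ x, TopologicalSpace (A x)]
  [TopologicalSpace (TotalSpace F A)] [FiberBundle F A] [VectorBundle ℝ F A]

/-- A pair of Lie algebroid structures on `A` and on `A*` is a Lie bialgebroid if the differential
`d⁎` of the Lie algebroid `A*` is a derivation of the Gerstenhaber algebra of sections of the
exterior powers of `A`: `d⁎[P, Q] = [d⁎P, Q] + (-1)^{k-1} [P, d⁎Q]` for every `k`-vector `P` and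
`l`-vector `Q`. The case `k = l = 0`, in which `[P, Q] = 0`, is listed separately. -/
structure IsLieBialgebroid (L : LieAlgebroid m F A)
    (L' : LieAlgebroid m (F →L[ℝ] ℝ) fun x ↦ A x →L[ℝ] ℝ) : Prop where
  zero_zero : ∀ P Q : FormField m (F →L[ℝ] ℝ) (fun x ↦ A x →L[ℝ] ℝ) 0,
    Cochain.schouten L.act L.br pairing 0 (Cochain.d L'.act L'.br P.eval) Q.eval -
      Cochain.schouten L.act L.br pairing 0 P.eval (Cochain.d L'.act L'.br Q.eval) = 0
  derivation : ∀ (k l n : ℕ), n + 1 = k + l →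
    ∀ (P : FormField m (F →L[ℝ] ℝ) (fun x ↦ A x →L[ℝ] ℝ) k)
      (Q : FormField m (F →L[ℝ] ℝ) (fun x ↦ A x →L[ℝ] ℝ) l),
      Cochain.d L'.act L'.br (Cochain.schouten L.act L.br pairing n P.eval Q.eval) =
        Cochain.schouten L.act L.br pairing (n + 1) (Cochain.d L'.act L'.br P.eval) Q.eval +
          (-1 : SmoothFun m M) ^ (k + 1) •
            Cochain.schouten L.act L.br pairing (n + 1) P.eval (Cochain.d L'.act L'.br Q.eval)

/-- The transpose `T*ₓM → Aₓ` of the anchor of a Lie algebroid structure on `A*`: the vector `a`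
with `⟨φ, a⟩ = ⟨α, ρ⁎(φ)⟩` for all `φ` in the fibre of `A*`. -/
def LieAlgebroid.anchorTranspose (L' : LieAlgebroid m (F →L[ℝ] ℝ) fun x ↦ A x →L[ℝ] ℝ) (x : M)
    (α : TangentSpace (𝓡 m) x →L[ℝ] ℝ) : A x :=
  Cochain.representer (fun (φ : A x →L[ℝ] ℝ) (a : A x) ↦ φ a) fun φ ↦ α (L'.anchor x φ)

/-- Sections `Ω` of the top exterior power of `A*` and `V` of that of `A` are dual to each other,
`⟨Ω, V⟩ = 1`. For `Ω = w e¹∧⋯∧eⁿ` and `V = v e₁∧⋯∧eₙ` in dual bases one has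
`Ω(X₁,…,Xₙ) V(θ₁,…,θₙ) = w v det ⟨θᵢ, Xⱼ⟩`, so that the identity below says `w v = 1`. -/
def IsDualVolume {n : ℕ} (Ω : FormField m F A n)
    (V : FormField m (F →L[ℝ] ℝ) (fun x ↦ A x →L[ℝ] ℝ) n) : Prop :=
  ∀ (x : M) (X : Fin n → A x) (θ : Fin n → A x →L[ℝ] ℝ),
    Ω.toFun x X * V.toFun x θ = (Matrix.of fun i j ↦ θ i (X j)).det

/-- The section `ξ₀` of `A*` is the modular cocycle of the Lie algebroid `A` with respect to `s ⊗ V`: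
`(L_{ρ(u)} s) ⊗ V + s ⊗ L_u V = ⟨ξ₀, u⟩ s ⊗ V` for all sections `u` of `A`. -/
def IsModularCocycle {n : ℕ} (L : LieAlgebroid m F A)
    (s : FormField m (EuclideanSpace ℝ (Fin m)) (fun x : M ↦ TangentSpace (𝓡 m) x) m)
    (V : FormField m (F →L[ℝ] ℝ) (fun x ↦ A x →L[ℝ] ℝ) n)
    (ξ₀ : Cₛ^∞⟮𝓡 m; F →L[ℝ] ℝ, fun x ↦ A x →L[ℝ] ℝ⟯) : Prop :=
  ∀ (u : Cₛ^∞⟮𝓡 m; F, A⟯) (Y : Fin m → VectorFields m M)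
    (θ : Fin n → Cₛ^∞⟮𝓡 m; F →L[ℝ] ℝ, fun x ↦ A x →L[ℝ] ℝ⟯),
    Cochain.lieForm VectorFields.act VectorFields.bracket (L.rho u) s.eval Y * V.eval θ +
        s.eval Y * Cochain.lieMulti L.act L.br pairing u V.eval θ =
      pairing ξ₀ u * (s.eval Y * V.eval θ)

/-- The section `X₀` of `A` is the modular cocycle of the Lie algebroid `A*` with respect to `Ω ⊗ s`:
`(L_θ Ω) ⊗ s + Ω ⊗ L_{ρ⁎(θ)} s = ⟨X₀, θ⟩ Ω ⊗ s` for all sections `θ` of `A*`. -/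
def IsDualModularCocycle {n : ℕ} (L' : LieAlgebroid m (F →L[ℝ] ℝ) fun x ↦ A x →L[ℝ] ℝ)
    (s : FormField m (EuclideanSpace ℝ (Fin m)) (fun x : M ↦ TangentSpace (𝓡 m) x) m)
    (Ω : FormField m F A n) (X₀ : Cₛ^∞⟮𝓡 m; F, A⟯) : Prop :=
  ∀ (θ : Cₛ^∞⟮𝓡 m; F →L[ℝ] ℝ, fun x ↦ A x →L[ℝ] ℝ⟯) (X : Fin n → Cₛ^∞⟮𝓡 m; F, A⟯)
    (Y : Fin m → VectorFields m M),
    Cochain.lieMulti L'.act L'.br pairing' θ Ω.eval X * s.eval Y +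
        Ω.eval X * Cochain.lieForm VectorFields.act VectorFields.bracket (L'.rho θ) s.eval Y =
      pairing θ X₀ * (Ω.eval X * s.eval Y)

end Bialgebroid

section Poisson

variable (m : ℕ) (M : Type*) [TopologicalSpace M] [ChartedSpace (EuclideanSpace ℝ (Fin m)) M]
  [IsManifold (𝓡 m) ∞ M]

/-- A smooth bivector field `π` on `M`, given by the skew-symmetric bundle map `π♯ : T*M → TM` with
`π(α, β) = ⟨β, π♯ α⟩`. -/
structure BivectorField where
  sharp : Cₛ^∞⟮𝓡 m; (EuclideanSpace ℝ (Fin m) →L[ℝ] ℝ) →L[ℝ] EuclideanSpace ℝ (Fin m),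
    fun x : M ↦ (TangentSpace (𝓡 m) x →L[ℝ] ℝ) →L[ℝ] TangentSpace (𝓡 m) x⟯
  skew : ∀ (x : M) (α β : TangentSpace (𝓡 m) x →L[ℝ] ℝ), β (sharp x α) = -α (sharp x β)

variable {m M}

/-- The Hamiltonian vector field `π♯(df)` of `f` with respect to the bivector field `π = P`. -/
def BivectorField.ham (P : BivectorField m M) (f : SmoothFun m M) : VectorFields m M :=
  ⟨fun x ↦ P.sharp x (differential f x),
    P.sharp.contMDiff.clm_bundle_apply (differential f).contMDiff⟩

/-- The bracket `{f, g} = π(df, dg) = π♯(df)(g)`, where `π = P`. -/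
def BivectorField.poissonBracket (P : BivectorField m M) (f g : SmoothFun m M) : SmoothFun m M :=
  (P.ham f).act g

/-- The bivector field is a Poisson bivector: `{·, ·}` satisfies the Jacobi identity. -/
def BivectorField.IsPoisson (P : BivectorField m M) : Prop :=
  ∀ f g h : SmoothFun m M, P.poissonBracket f (P.poissonBracket g h) =
    P.poissonBracket (P.poissonBracket f g) h + P.poissonBracket g (P.poissonBracket f h)

/-- `Z` is the modular vector field of `π = P` with respect to the volume form `s`:
`L_{π♯(df)} s = Z(f) s` for all functions `f`. -/
def BivectorField.IsModularVectorField (P : BivectorField m M)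
    (s : FormField m (EuclideanSpace ℝ (Fin m)) (fun x : M ↦ TangentSpace (𝓡 m) x) m)
    (Z : VectorFields m M) : Prop :=
  ∀ (f : SmoothFun m M) (Y : Fin m → VectorFields m M),
    Cochain.lieForm VectorFields.act VectorFields.bracket (P.ham f) s.eval Y =
      Z.act f * s.eval Y

end Poisson

end

/-! Fix a function `f` and put `u = d⁎f` in `Γ(A)` and `θ = df` in `Γ(A*)`, the differentials of `f`
for `L'` and `L`. The derivation rule is needed only in its two lowest degrees.

On two functions it says `ρ(d⁎f)g = -ρ(d⁎g)f`. This is the skew-symmetry of `π♯ = ρ ∘ (ρ⁎)*`, and it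
also gives `ρ⁎(θ) = -ρ(u)` (`act_dual_differential_skew`, `rho_differential`). On a function and a
section it says `[u, X] = -L_θ X` (`pairing_br_dual_differential`). For `X = d⁎g` this becomes
`[d⁎f, d⁎g] = d⁎{f,g}`, and the Jacobi identity of `{·,·}` is then the fact that `ρ` respects
brackets.

For the modular field, differentiate `Ω(X)V(η) = det⟨ηᵢ, Xⱼ⟩` along `ρ(u)`. The second identity
turns the result into `L_u V / V = L_θ Ω / Ω` (`lieMulti_dual_differential`). Since `L_{ρ⁎(θ)} s =
-L_{ρ(u)} s`, subtracting the equation of `X₀` at `θ` from that of `ξ₀` at `u` cancels these two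
quotients and leaves `2 L_{ρ(u)} s = (⟨ξ₀,u⟩ - ⟨X₀,θ⟩) s`. Finally `⟨ξ₀,u⟩ = ρ⁎(ξ₀)f`, `⟨X₀,θ⟩ =
ρ(X₀)f`, and `ρ(u) = π♯(df)`. -/

/-! ### Local frames with cutoffs, and extension to global sections -/

section Frames

variable {m : ℕ} {M : Type*} [TopologicalSpace M] [ChartedSpace (EuclideanSpace ℝ (Fin m)) M]
  {F : Type*} [NormedAddCommGroup F] [NormedSpace ℝ F]
  {E : M → Type*} [∀ x, AddCommGroup (E x)] [∀ x, Module ℝ (E x)] [∀ x, TopologicalSpace (E x)]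
  [TopologicalSpace (TotalSpace F E)] [FiberBundle F E] [VectorBundle ℝ F E]

/-- A smooth cutoff function that equals `1` near `x` and is supported in a given neighbourhood. -/
theorem exists_smoothFun_cutoff [IsManifold (𝓡 m) ∞ M] [T2Space M] (x : M) {s : Set M} (hs : s ∈ nhds x) :
    ∃ ψ : SmoothFun m M, (∀ᶠ y in nhds x, ψ y = 1) ∧ tsupport ψ ⊆ s := by
  obtain ⟨f, hf, -⟩ := (SmoothBumpFunction.nhds_basis_support (I := 𝓡 m) hs).mem_iff.1 hs
  exact ⟨⟨f, f.contMDiff⟩, f.eventuallyEq_one, hf⟩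

theorem contMDiffAt_sum_smul_section {ι : Type*} [Fintype ι] {a : ι → M → ℝ}
    (e : ι → Cₛ^∞⟮𝓡 m; F, E⟯) {x : M} (ha : ∀ i, ContMDiffAt (𝓡 m) 𝓘(ℝ, ℝ) ∞ (a i) x) :
    ContMDiffAt (𝓡 m) ((𝓡 m).prod 𝓘(ℝ, F)) ∞
      (fun y ↦ TotalSpace.mk' F y (∑ i, a i y • e i y)) x :=
  ContMDiffAt.sum_section fun i _ ↦ (ha i).smul_section ((e i).contMDiff x)

variable [IsManifold (𝓡 m) ∞ M] [T2Space M] [FiniteDimensional ℝ F]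
  [ContMDiffVectorBundle ∞ F E (𝓡 m)]

variable (F E) in
/-- Near every point the smooth sections are finitely generated, with coefficients that are
defined globally. -/
theorem exists_cutoff_frame (x : M) : ∃ (ψ : SmoothFun m M) (e : Fin (Module.finrank ℝ F) → Cₛ^∞⟮𝓡 m; F, E⟯)
    (c : Fin (Module.finrank ℝ F) → ∀ y, E y →ₗ[ℝ] ℝ),
    (∀ᶠ y in nhds x, ψ y = 1) ∧
    (∀ i, ∀ᶠ y in nhds x, e i y = (trivializationAt F E x).localFrame (Module.finBasis ℝ F) i y) ∧
    (∀ (X : Cₛ^∞⟮𝓡 m; F, E⟯) i, ContMDiff (𝓡 m) 𝓘(ℝ, ℝ) ∞ fun y ↦ c i y (X y)) ∧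
    ∀ y (v : E y), ψ y • v = ∑ i, c i y v • e i y := by
  have : ContMDiffVectorBundle 1 F E (𝓡 m) := ContMDiffVectorBundle.of_le (n := ∞) (by norm_cast)
  set t := trivializationAt F E x
  have hx : x ∈ t.baseSet := FiberBundle.mem_baseSet_trivializationAt F E x
  obtain ⟨ψ, hψ, hsupp⟩ := exists_smoothFun_cutoff (m := m) x (t.open_baseSet.mem_nhds hx)
  set b := Module.finBasis ℝ F
  -- One factor `ψ` globalizes the frame and the other globalizes the coefficients, so their product
  -- is `ψ²`.
  refine ⟨ψ * ψ, fun i ↦ ⟨fun y ↦ ψ y • t.localFrame b i y, ?_⟩,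
    fun i y ↦ ψ y • t.localFrameCoeff (𝓡 m) b i y, ?_, ?_, ?_, ?_⟩
  · exact ContMDiffOn.smul_section_of_tsupport ψ.contMDiff.contMDiffOn t.open_baseSet hsupp
      (t.contMDiffOn_localFrame_baseSet ∞ b i)
  · filter_upwards [hψ] with y hy
    simp [hy]
  · intro i
    filter_upwards [hψ] with y hy
    simp [hy, t]
  · intro X i
    have h1 := contMDiffOn_baseSet_localFrameCoeff (I := 𝓡 m) b (e := t) (k := ∞)
      X.contMDiff.contMDiffOn i
    refine contMDiff_of_tsupport fun y hy ↦ ?_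
    have hy' : y ∈ t.baseSet := hsupp (closure_mono (fun z hz ↦ by
      simp only [Function.mem_support] at hz ⊢
      intro h0
      exact hz (by simp [h0])) hy)
    exact (ψ.contMDiff y).mul (h1.contMDiffAt (t.open_baseSet.mem_nhds hy'))
  · classical
    intro y v
    by_cases hy : y ∈ t.baseSet
    -- Coefficients at `y` depend only on the value at `y`, so the discontinuous extension of `v` by
    -- zero serves as the section.
    · have := t.eq_sum_localFrameCoeff_smul (I := 𝓡 m) (b := b) (s := Function.update 0 y v) hy
      rw [Function.update_self] at this
      conv_lhs => rw [this]
      simp [Finset.smul_sum, smul_smul]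
      refine Finset.sum_congr rfl fun i _ ↦ ?_
      congr 1
      ring
    · have : ψ y = 0 := image_eq_zero_of_notMem_tsupport fun h ↦ hy (hsupp h)
      simp [this]

variable (F) in
/-- Every vector extends to a global smooth section. -/
theorem exists_section_apply_eq (x : M) (v : E x) : ∃ X : Cₛ^∞⟮𝓡 m; F, E⟯, X x = v := by
  obtain ⟨ψ, e, c, h1, -, -, h4⟩ := exists_cutoff_frame (m := m) F E x
  refine ⟨⟨fun y ↦ ∑ i, c i x v • e i y, fun y ↦ contMDiffAt_sum_smul_section e fun i ↦ contMDiffAt_const⟩, ?_⟩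
  change ∑ i, c i x v • e i x = v
  rw [← h4, h1.self_of_nhds, one_smul]

/-- A fibrewise linear map that takes smooth sections to smooth sections is smooth. -/
theorem contMDiff_hom_of_apply {F' : Type*} [NormedAddCommGroup F'] [NormedSpace ℝ F']
    {E' : M → Type*} [∀ x, AddCommGroup (E' x)] [∀ x, Module ℝ (E' x)]
    [∀ x, TopologicalSpace (E' x)] [TopologicalSpace (TotalSpace F' E')] [FiberBundle F' E']
    [VectorBundle ℝ F' E'] [∀ x, IsTopologicalAddGroup (E' x)] [∀ x, ContinuousSMul ℝ (E' x)]
    (T : ∀ x, E x →L[ℝ] E' x)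
    (hT : ∀ X : Cₛ^∞⟮𝓡 m; F, E⟯, ContMDiff (𝓡 m) ((𝓡 m).prod 𝓘(ℝ, F')) ∞
      fun x ↦ TotalSpace.mk' F' x (T x (X x))) :
    ContMDiff (𝓡 m) ((𝓡 m).prod 𝓘(ℝ, F →L[ℝ] F')) ∞
      fun x ↦ TotalSpace.mk' (F →L[ℝ] F') (E := fun x ↦ E x →L[ℝ] E' x) x (T x) := by
  intro x
  rw [contMDiffAt_hom_bundle]
  refine ⟨contMDiffAt_id, ?_⟩
  obtain ⟨ψ, e, c, -, h2, -, -⟩ := exists_cutoff_frame (m := m) F E x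
  set b := Module.finBasis ℝ F
  -- A linear map is a fixed linear expression in its values on a basis, so smoothness need only be
  -- checked on each basis vector, where the map is `T` applied to the section `e i`.
  have key : ∀ G : F →L[ℝ] F', G = ∑ i, (LinearMap.toContinuousLinearMap (b.coord i)).smulRight (G (b i)) := by
    intro G
    ext v
    conv_lhs => rw [← b.sum_repr v, map_sum]
    simp
  have h : ∀ i, ContMDiffAt (𝓡 m) 𝓘(ℝ, F') ∞
      (fun y ↦ ContinuousLinearMap.inCoordinates F E F' E' x y x y (T y) (b i)) x := by
    intro i
    have h3 := (contMDiffAt_section _).1 (hT (e i) x)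
    refine h3.congr_of_eventuallyEq ?_
    filter_upwards [h2 i, (trivializationAt F E x).open_baseSet.mem_nhds
      (FiberBundle.mem_baseSet_trivializationAt F E x),
      (trivializationAt F' E' x).open_baseSet.mem_nhds
      (FiberBundle.mem_baseSet_trivializationAt F' E' x)] with y hy hy1 hy2
    rw [hy, ContinuousLinearMap.inCoordinates_eq hy1 hy2]
    simp [hy1, Trivialization.basisAt]
  have hs : ContMDiffAt (𝓡 m) 𝓘(ℝ, F →L[ℝ] F') ∞ (fun y ↦ ∑ i,
      (LinearMap.toContinuousLinearMap (b.coord i)).smulRight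
        (ContinuousLinearMap.inCoordinates F E F' E' x y x y (T y) (b i))) x := by
    refine contMDiffAt_finsetSum fun i _ ↦ ?_
    exact ((ContinuousLinearMap.smulRightL ℝ F F' (LinearMap.toContinuousLinearMap (b.coord i))).contMDiff _).comp x (h i)
  refine hs.congr_of_eventuallyEq (Filter.Eventually.of_forall fun y ↦ ?_)
  exact key _

end Frames

/-! ### Fibrewise duality and sections of the dual bundle -/

theorem dual_separates {M : Type*} [TopologicalSpace M]
    (F : Type*) [NormedAddCommGroup F] [NormedSpace ℝ F]
    {E : M → Type*} [∀ x, AddCommGroup (E x)] [∀ x, Module ℝ (E x)] [∀ x, TopologicalSpace (E x)]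
    [TopologicalSpace (TotalSpace F E)] [FiberBundle F E] [VectorBundle ℝ F E] (x : M) {v w : E x} (h : ∀ a : E x →L[ℝ] ℝ, a v = a w) : v = w := by
  let Φ := VectorBundle.continuousLinearEquivAt ℝ F E x
  apply Φ.injective
  by_contra hne
  obtain ⟨f, hf⟩ := SeparatingDual.exists_separating_of_ne (R := ℝ) hne
  exact hf (h (f.comp (Φ : E x →L[ℝ] F)))

/-- Linear maps on the fibres of a vector bundle of finite rank are continuous. -/
theorem LinearMap.continuous_of_fiber {M : Type*} [TopologicalSpace M]
    (F : Type*) [NormedAddCommGroup F] [NormedSpace ℝ F] [FiniteDimensional ℝ F]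
    {E : M → Type*} [∀ x, AddCommGroup (E x)] [∀ x, Module ℝ (E x)] [∀ x, TopologicalSpace (E x)]
    [TopologicalSpace (TotalSpace F E)] [FiberBundle F E] [VectorBundle ℝ F E] {x : M}
    {G : Type*} [AddCommGroup G] [Module ℝ G] [TopologicalSpace G] [IsTopologicalAddGroup G]
    [ContinuousSMul ℝ G] (c : E x →ₗ[ℝ] G) : Continuous c := by
  let Φ := VectorBundle.continuousLinearEquivAt ℝ F E x
  have h : Continuous (c.comp Φ.symm.toLinearEquiv.toLinearMap) :=
    LinearMap.continuous_of_finiteDimensional _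
  convert h.comp Φ.continuous using 1
  ext v
  simp

section Duality

variable {m : ℕ} {M : Type*} [TopologicalSpace M] [ChartedSpace (EuclideanSpace ℝ (Fin m)) M]
  [IsManifold (𝓡 m) ∞ M] [T2Space M]
  {F : Type*} [NormedAddCommGroup F] [NormedSpace ℝ F] [FiniteDimensional ℝ F]
  {E : M → Type*} [∀ x, AddCommGroup (E x)] [∀ x, Module ℝ (E x)] [∀ x, TopologicalSpace (E x)]
  [TopologicalSpace (TotalSpace F E)] [FiberBundle F E] [VectorBundle ℝ F E]
  [ContMDiffVectorBundle ∞ F E (𝓡 m)]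

/-- A family of linear forms on the fibres that is smooth on smooth sections is a smooth section of
the dual bundle. -/
theorem exists_dualSection_of_smooth (c : ∀ x, E x →ₗ[ℝ] ℝ)
    (hc : ∀ X : Cₛ^∞⟮𝓡 m; F, E⟯, ContMDiff (𝓡 m) 𝓘(ℝ, ℝ) ∞ fun x ↦ c x (X x)) :
    ∃ θ : Cₛ^∞⟮𝓡 m; F →L[ℝ] ℝ, fun x ↦ E x →L[ℝ] ℝ⟯, ∀ x v, θ x v = c x v := by
  have hcont : ∀ x, Continuous (c x) := fun x ↦ (c x).continuous_of_fiber F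
  refine ⟨⟨fun x ↦ ⟨c x, hcont x⟩, ?_⟩, fun x v ↦ rfl⟩
  refine contMDiff_hom_of_apply (F' := ℝ) (E' := fun _ ↦ ℝ) (fun x ↦ ⟨c x, hcont x⟩) fun X x ↦ ?_
  rw [contMDiffAt_section]
  exact hc X x

variable (F) in
/-- Covectors at a point extend to smooth sections of the dual bundle. -/
theorem exists_dualSection_apply_eq (x : M) (a : E x →L[ℝ] ℝ) :
    ∃ θ : Cₛ^∞⟮𝓡 m; F →L[ℝ] ℝ, fun x ↦ E x →L[ℝ] ℝ⟯, θ x = a := by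
  obtain ⟨ψ, e, c, h1, -, h3, h4⟩ := exists_cutoff_frame (m := m) F E x
  obtain ⟨θ, hθ⟩ := exists_dualSection_of_smooth (m := m) (F := F)
    (fun y ↦ ∑ i, a (e i x) • c i y) fun X ↦ by
      simp only [LinearMap.sum_apply, LinearMap.smul_apply]
      exact contMDiff_finsetSum fun i _ ↦ contMDiff_const.mul (h3 X i)
  refine ⟨θ, ContinuousLinearMap.ext fun v ↦ ?_⟩
  have h := h4 x v
  rw [h1.self_of_nhds, one_smul] at h
  conv_rhs => rw [h]
  simp [hθ, mul_comm]

theorem section_ext_of_pairing {X Y : Cₛ^∞⟮𝓡 m; F, E⟯}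
    (h : ∀ θ : Cₛ^∞⟮𝓡 m; F →L[ℝ] ℝ, fun x ↦ E x →L[ℝ] ℝ⟯, pairing θ X = pairing θ Y) : X = Y := by
  ext x
  refine dual_separates F x fun a ↦ ?_
  obtain ⟨θ, rfl⟩ := exists_dualSection_apply_eq (m := m) F x a
  exact DFunLike.congr_fun (h θ) x

theorem dualSection_ext_of_pairing {θ η : Cₛ^∞⟮𝓡 m; F →L[ℝ] ℝ, fun x ↦ E x →L[ℝ] ℝ⟯}
    (h : ∀ X : Cₛ^∞⟮𝓡 m; F, E⟯, pairing θ X = pairing η X) : θ = η := by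
  ext x v
  obtain ⟨X, rfl⟩ := exists_section_apply_eq (m := m) F x v
  exact DFunLike.congr_fun (h X) x

/-- A `C^∞`-linear functional on the sections of the dual bundle is the pairing with a section. -/
theorem exists_pairing_eq (φ : Cₛ^∞⟮𝓡 m; F →L[ℝ] ℝ, fun x ↦ E x →L[ℝ] ℝ⟯ → SmoothFun m M)
    (hadd : ∀ θ η, φ (θ + η) = φ θ + φ η)
    (hmul : ∀ (f : SmoothFun m M) θ, φ (mulSection f θ) = f * φ θ) :
    ∃ X : Cₛ^∞⟮𝓡 m; F, E⟯, ∀ θ, pairing θ X = φ θ := by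
  have hloc : ∀ x : M, ∃ X : Cₛ^∞⟮𝓡 m; F, E⟯, ∀ᶠ y in nhds x, ∀ θ, pairing θ X y = φ θ y := by
    intro x
    obtain ⟨ψ, e, c, h1, -, h3, h4⟩ := exists_cutoff_frame (m := m) F E x
    choose ε hε using fun i ↦ exists_dualSection_of_smooth (m := m) (F := F) (c i) fun X ↦ h3 X i
    have hzero : φ 0 = 0 := by simpa using hadd 0 0
    have hsum : ∀ (s : Finset (Fin (Module.finrank ℝ F)))
        (g : Fin (Module.finrank ℝ F) → Cₛ^∞⟮𝓡 m; F →L[ℝ] ℝ, fun x ↦ E x →L[ℝ] ℝ⟯),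
        φ (∑ i ∈ s, g i) = ∑ i ∈ s, φ (g i) := by
      intro s g
      exact map_sum (AddMonoidHom.mk' φ hadd) g s
    refine ⟨∑ i, mulSection (φ (ε i)) (e i), ?_⟩
    filter_upwards [h1] with y hy θ
    -- The cutoff makes the expansion of `ψθ` in the `ε i` global, so `φ` can be applied to it
    -- termwise; near `x` the factor `ψ` is `1`.
    have hexp : mulSection ψ θ = ∑ i, mulSection (pairing θ (e i)) (ε i) := by
      refine dualSection_ext_of_pairing fun X ↦ ?_
      ext z
      have := congrArg (θ z) (h4 z (X z))
      simp only [map_smul, map_sum] at this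
      have h5 : ∀ s : Finset (Fin (Module.finrank ℝ F)), (∑ i ∈ s, mulSection (pairing θ (e i)) (ε i)) z (X z) =
          ∑ i ∈ s, c i z (X z) * θ z (e i z) := by
        intro s
        induction s using Finset.cons_induction with
        | empty => simp
        | cons a s ha ih =>
          rw [Finset.sum_cons, Finset.sum_cons, ← ih, ← hε, mul_comm]
          rfl
      exact this.trans (h5 _).symm
    have h6 := DFunLike.congr_fun (congrArg φ hexp) y
    rw [hmul, hsum] at h6
    have h7 : ∀ s : Finset (Fin (Module.finrank ℝ F)),
        θ y ((∑ i ∈ s, mulSection (φ (ε i)) (e i)) y) =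
          (∑ i ∈ s, φ (mulSection (pairing θ (e i)) (ε i))) y := by
      intro s
      induction s using Finset.cons_induction with
      | empty => simp
      | cons a s ha ih =>
        rw [Finset.sum_cons, Finset.sum_cons, hmul]
        change θ y (φ (ε a) y • e a y + (∑ i ∈ s, mulSection (φ (ε i)) (e i)) y) = _ * _ + _
        rw [map_add, ih, map_smul, smul_eq_mul, mul_comm]
        rfl
    refine (h7 _).trans (h6.symm.trans ?_)
    change ψ y * φ θ y = φ θ y
    rw [hy, one_mul]
  choose X hX using hloc
  -- Local representatives agree where both are valid, because dual sections separate vectors; hence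
  -- the diagonal `x ↦ X x x` is smooth.
  have heq : ∀ x, ∀ᶠ y in nhds x, X y y = X x y := by
    intro x
    filter_upwards [hX x] with y hy
    refine dual_separates F y fun a ↦ ?_
    obtain ⟨θ, rfl⟩ := exists_dualSection_apply_eq (m := m) F y a
    exact ((hX y).self_of_nhds θ).trans (hy θ).symm
  refine ⟨⟨fun x ↦ X x x, fun x ↦ ?_⟩, fun θ ↦ ?_⟩
  · refine ((X x).contMDiff x).congr_of_eventuallyEq ?_
    filter_upwards [heq x] with y hy
    rw [hy]
  · ext x
    exact (hX x).self_of_nhds θ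

end Duality

/-- Every use of the choice in `representer` is eliminated here: a known solution that the pairing
determines uniquely must be the chosen one. -/
theorem Cochain.representer_eq {R N N' : Type*} [AddCommGroup N] {pair : N' → N → R} {φ : N' → R} {X : N}
    (hX : ∀ θ, pair θ X = φ θ) (hinj : ∀ Y, (∀ θ, pair θ Y = pair θ X) → Y = X) :
    Cochain.representer pair φ = X := by
  have h : ∃ X, ∀ θ, pair θ X = φ θ := ⟨X, hX⟩
  rw [Cochain.representer, dif_pos h]
  exact hinj _ fun θ ↦ (h.choose_spec θ).trans (hX θ).symm

/-! ### Vector fields as derivations of functions -/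

section Functions

variable {m : ℕ} {M : Type*} [TopologicalSpace M] [ChartedSpace (EuclideanSpace ℝ (Fin m)) M]

theorem SmoothFun.mdifferentiableAt (f : SmoothFun m M) (x : M) :
    MDifferentiableAt (𝓡 m) 𝓘(ℝ, ℝ) f x :=
  (f.contMDiff x).mdifferentiableAt (by simp)

variable [IsManifold (𝓡 m) ∞ M]

/-- The derivation of `C^∞(M)` given by a vector field. -/
noncomputable def VectorFields.toDerivation (X : VectorFields m M) :
    Derivation ℝ (SmoothFun m M) (SmoothFun m M) :=
  Derivation.mk'
    { toFun := X.act
      map_add' := fun f g ↦ by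
        ext x
        change mfderiv (𝓡 m) 𝓘(ℝ, ℝ) (⇑f + ⇑g) x (X x) = _
        rw [mfderiv_add (f.mdifferentiableAt x) (g.mdifferentiableAt x)]
        rfl
      map_smul' := fun a f ↦ by
        ext x
        change mfderiv (𝓡 m) 𝓘(ℝ, ℝ) (a • ⇑f) x (X x) = _
        rw [const_smul_mfderiv (f.mdifferentiableAt x)]
        rfl }
    fun f g ↦ by
      ext x
      change mfderiv (𝓡 m) 𝓘(ℝ, ℝ) (⇑f * ⇑g) x (X x) = _
      rw [((f.mdifferentiableAt x).hasMFDerivAt.mul (g.mdifferentiableAt x).hasMFDerivAt).mfderiv]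
      rfl

variable [T2Space M]

/-- Every covector is the differential of a smooth function. -/
theorem exists_differential_eq (x : M) (α : TangentSpace (𝓡 m) x →L[ℝ] ℝ) :
    ∃ f : SmoothFun m M, differential f x = α := by
  obtain ⟨ψ, hψ, hsupp⟩ := exists_smoothFun_cutoff (m := m) x
    ((chartAt (EuclideanSpace ℝ (Fin m)) x).open_source.mem_nhds (mem_chart_source _ x))
  have hinv := isInvertible_mfderiv_extChartAt (I := 𝓡 m) (x := x) (mem_extChartAt_source x)
  set B := (mfderiv (𝓡 m) 𝓘(ℝ, EuclideanSpace ℝ (Fin m)) (extChartAt (𝓡 m) x) x)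
  -- The covector is transported to the chart; the function sought is this linear form in the
  -- coordinates, cut off by `ψ`.
  let G : EuclideanSpace ℝ (Fin m) →L[ℝ] ℝ := α.comp B.inverse
  have hg : ContMDiffOn (𝓡 m) 𝓘(ℝ, ℝ) ∞ (fun y ↦ G (extChartAt (𝓡 m) x y))
      (chartAt (EuclideanSpace ℝ (Fin m)) x).source :=
    G.contMDiff.comp_contMDiffOn contMDiffOn_extChartAt
  have hsm : ContMDiff (𝓡 m) 𝓘(ℝ, ℝ) ∞ fun y ↦ ψ y * G (extChartAt (𝓡 m) x y) := by
    refine contMDiff_of_tsupport fun y hy ↦ ?_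
    have hy' : y ∈ (chartAt (EuclideanSpace ℝ (Fin m)) x).source :=
      hsupp (closure_mono (fun z hz ↦ by
        simp only [Function.mem_support] at hz ⊢
        intro h0
        exact hz (by simp [h0])) hy)
    exact (ψ.contMDiff y).mul (hg.contMDiffAt ((chartAt _ x).open_source.mem_nhds hy'))
  refine ⟨⟨_, hsm⟩, ?_⟩
  have h1 : mfderiv (𝓡 m) 𝓘(ℝ, ℝ) (fun y ↦ ψ y * G (extChartAt (𝓡 m) x y)) x =
      mfderiv (𝓡 m) 𝓘(ℝ, ℝ) (G ∘ extChartAt (𝓡 m) x) x := by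
    refine Filter.EventuallyEq.mfderiv_eq ?_
    filter_upwards [hψ] with y hy
    simp [hy]
  have h2 : mfderiv (𝓡 m) 𝓘(ℝ, ℝ) (G ∘ extChartAt (𝓡 m) x) x = G.comp B := by
    rw [mfderiv_comp x G.mdifferentiableAt
      (mdifferentiableAt_extChartAt (mem_chart_source _ x)), G.mfderiv_eq]
    rfl
  refine (h1.trans h2).trans ?_
  ext v
  change α (B.inverse (B v)) = α v
  rw [hinv.inverse_apply_eq.2 rfl]

theorem VectorFields.ext_of_act {X Y : VectorFields m M} (h : ∀ f, X.act f = Y.act f) : X = Y := by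
  ext x : 1
  have hs : ∀ α : TangentSpace (𝓡 m) x →L[ℝ] ℝ, α (X x) = α (Y x) := fun α ↦ by
    obtain ⟨f, rfl⟩ := exists_differential_eq x α
    exact DFunLike.congr_fun (h f) x
  exact dual_separates (EuclideanSpace ℝ (Fin m)) (E := fun x : M ↦ TangentSpace (𝓡 m) x) x hs

end Functions

/-! ### Cochains and Schouten brackets in low degree -/

namespace Cochain

variable {R N N' : Type*} [CommRing R]

theorem d_zero_apply (act : N → R → R) (br : N → N → N) (α : (Fin 0 → N) → R) (X : Fin 1 → N) :
    d act br α X = act (X 0) (α fun i ↦ i.elim0) := by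
  unfold d
  rw [Fin.sum_univ_one, Fin.sum_univ_one, Fin.sum_univ_zero, add_zero]
  simp only [Fin.val_zero, pow_zero, one_mul]
  congr 2
  exact Subsingleton.elim _ _

theorem d_one_apply (act : N → R → R) (br : N → N → N) (α : (Fin 1 → N) → R) (X : Fin 2 → N) :
    d act br α X = act (X 0) (α fun _ ↦ X 1) - act (X 1) (α fun _ ↦ X 0) -
      α fun _ ↦ br (X 0) (X 1) := by
  have h0 : (fun i : Fin 1 ↦ X ((0 : Fin 2).succAbove i)) = fun _ ↦ X 1 := by
    funext i; fin_cases i; rfl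
  have h1 : (fun i : Fin 1 ↦ X ((1 : Fin 2).succAbove i)) = fun _ ↦ X 0 := by
    funext i; fin_cases i; rfl
  have h2 : Function.update (fun _ : Fin 1 ↦ X 0) 0 (br (X 0) (X 1)) = fun _ ↦ br (X 0) (X 1) := by
    funext i; fin_cases i; rfl
  unfold d
  rw [Fin.sum_univ_two, Fin.sum_univ_two, Fin.sum_univ_one, Fin.sum_univ_one, h0, h1]
  simp [h2]
  ring

variable [Algebra ℝ R] [AddCommGroup N] [AddCommGroup N']

/-- For brackets of total degree at most one the only permutation is the identity and the factorials
are `1`, so the shuffle sum has a single term. -/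
theorem derivTerm_apply_of_subsingleton (act : N → R → R) (pair : N' → N → R) {p l n : ℕ}
    [Subsingleton (Equiv.Perm (Fin n))] (hp : p.factorial = 1) (hl : l.factorial = 1)
    (P : (Fin (p + 1) → N') → R) (Q : (Fin l → N') → R) (θ : Fin n → N') :
    derivTerm act pair n P Q θ = act (sharp pair P (slice θ 0 p)) (Q (slice θ p l)) := by
  rw [derivTerm, Fintype.sum_subsingleton _ 1]
  simp [hp, hl]

theorem contractTerm_apply_of_subsingleton (act : N → R → R) (br : N → N → N)
    (pair : N' → N → R) {p q n : ℕ}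
    [Subsingleton (Equiv.Perm (Fin n))] (hp : p.factorial = 1) (hq : q.factorial = 1)
    (P : (Fin (p + 1) → N') → R) (Q : (Fin (q + 1) → N') → R) (θ : Fin n → N') :
    contractTerm act br pair n P Q θ =
      dTwo act br pair (entry θ 0) (sharp pair P (slice θ 1 p)) (sharp pair Q (slice θ (1 + p) q)) := by
  rw [contractTerm, Fintype.sum_subsingleton _ 1]
  simp [hp, hq]

end Cochain

section FormFields

variable {m : ℕ} {M : Type*} [TopologicalSpace M] [ChartedSpace (EuclideanSpace ℝ (Fin m)) M]
  {F : Type*} [NormedAddCommGroup F] [NormedSpace ℝ F]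
  {E : M → Type*} [∀ x, AddCommGroup (E x)] [∀ x, Module ℝ (E x)] [∀ x, TopologicalSpace (E x)]
  [TopologicalSpace (TotalSpace F E)] [FiberBundle F E]

variable (F E) in
/-- A smooth function as a form of degree zero. -/
noncomputable def FormField.ofFun (f : SmoothFun m M) : FormField m F E 0 where
  toFun x := AlternatingMap.constOfIsEmpty ℝ (E x) (Fin 0) (f x)
  smooth _ := f.contMDiff

@[simp]
theorem FormField.ofFun_eval (f : SmoothFun m M) (X : Fin 0 → Cₛ^∞⟮𝓡 m; F, E⟯) :
    (FormField.ofFun F E f).eval X = f := rfl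

variable [VectorBundle ℝ F E]

/-- A section of `E` as a form of degree one on the dual bundle. -/
noncomputable def FormField.ofSection (X : Cₛ^∞⟮𝓡 m; F, E⟯) :
    FormField m (F →L[ℝ] ℝ) (fun x ↦ E x →L[ℝ] ℝ) 1 where
  toFun x := AlternatingMap.ofSubsingleton ℝ (E x →L[ℝ] ℝ) ℝ (0 : Fin 1)
    { toFun := fun a ↦ a (X x), map_add' := fun _ _ ↦ rfl, map_smul' := fun _ _ ↦ rfl }
  smooth θ := (pairing (θ 0) X).contMDiff

@[simp]
theorem FormField.ofSection_eval (X : Cₛ^∞⟮𝓡 m; F, E⟯)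
    (θ : Fin 1 → Cₛ^∞⟮𝓡 m; F →L[ℝ] ℝ, fun x ↦ E x →L[ℝ] ℝ⟯) :
    (FormField.ofSection X).eval θ = pairing (θ 0) X := rfl

end FormFields

/-! ### Calculus in a single Lie algebroid -/

section Algebroid

variable {m : ℕ} {M : Type*} [TopologicalSpace M] [ChartedSpace (EuclideanSpace ℝ (Fin m)) M]
  {F : Type*} [NormedAddCommGroup F] [NormedSpace ℝ F]
  {E : M → Type*} [∀ x, AddCommGroup (E x)] [∀ x, Module ℝ (E x)] [∀ x, TopologicalSpace (E x)]
  [TopologicalSpace (TotalSpace F E)] [FiberBundle F E] [VectorBundle ℝ F E]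

theorem pairing_add_left (θ η : Cₛ^∞⟮𝓡 m; F →L[ℝ] ℝ, fun x ↦ E x →L[ℝ] ℝ⟯)
    (X : Cₛ^∞⟮𝓡 m; F, E⟯) : pairing (θ + η) X = pairing θ X + pairing η X := rfl

theorem pairing_neg_left (θ : Cₛ^∞⟮𝓡 m; F →L[ℝ] ℝ, fun x ↦ E x →L[ℝ] ℝ⟯)
    (X : Cₛ^∞⟮𝓡 m; F, E⟯) : pairing (-θ) X = -pairing θ X := rfl

theorem pairing_neg_right (θ : Cₛ^∞⟮𝓡 m; F →L[ℝ] ℝ, fun x ↦ E x →L[ℝ] ℝ⟯)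
    (X : Cₛ^∞⟮𝓡 m; F, E⟯) : pairing θ (-X) = -pairing θ X := by
  ext x
  exact map_neg (θ x) (X x)

theorem mulSection_apply (f : SmoothFun m M) (X : Cₛ^∞⟮𝓡 m; F, E⟯) (x : M) :
    mulSection f X x = f x • X x := rfl

theorem pairing_mulSection_left (f : SmoothFun m M)
    (θ : Cₛ^∞⟮𝓡 m; F →L[ℝ] ℝ, fun x ↦ E x →L[ℝ] ℝ⟯)
    (X : Cₛ^∞⟮𝓡 m; F, E⟯) : pairing (mulSection f θ) X = f * pairing θ X := rfl

variable [IsManifold (𝓡 m) ∞ M]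

namespace LieAlgebroid

variable (L : LieAlgebroid m F E)

theorem br_neg_swap (X Y : Cₛ^∞⟮𝓡 m; F, E⟯) : L.br X Y = -L.br Y X := by
  have h := L.bracket_self (X + Y)
  simp only [map_add, LinearMap.add_apply, L.bracket_self, zero_add, add_zero] at h
  exact eq_neg_of_add_eq_zero_right h

theorem br_add_left (X Y Z : Cₛ^∞⟮𝓡 m; F, E⟯) : L.br (X + Y) Z = L.br X Z + L.br Y Z := by
  simp [br]

theorem act_eq_toDerivation (X : Cₛ^∞⟮𝓡 m; F, E⟯) (f : SmoothFun m M) :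
    L.act X f = (L.rho X).toDerivation f := rfl

theorem act_add_left (X Y : Cₛ^∞⟮𝓡 m; F, E⟯) (f : SmoothFun m M) :
    L.act (X + Y) f = L.act X f + L.act Y f := by
  ext x
  change mfderiv (𝓡 m) 𝓘(ℝ, ℝ) f x (L.anchor x (X x + Y x)) = _
  rw [map_add, map_add]
  rfl

theorem act_mulSection (g : SmoothFun m M) (X : Cₛ^∞⟮𝓡 m; F, E⟯) (f : SmoothFun m M) :
    L.act (mulSection g X) f = g * L.act X f := by
  ext x
  change mfderiv (𝓡 m) 𝓘(ℝ, ℝ) f x (L.anchor x (g x • X x)) = _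
  rw [map_smul, map_smul]
  rfl

theorem act_neg (X : Cₛ^∞⟮𝓡 m; F, E⟯) (f : SmoothFun m M) : L.act X (-f) = -L.act X f :=
  map_neg (L.rho X).toDerivation f

theorem act_add (X : Cₛ^∞⟮𝓡 m; F, E⟯) (f g : SmoothFun m M) :
    L.act X (f + g) = L.act X f + L.act X g :=
  map_add (L.rho X).toDerivation f g

theorem act_mul (X : Cₛ^∞⟮𝓡 m; F, E⟯) (f g : SmoothFun m M) :
    L.act X (f * g) = f * L.act X g + g * L.act X f :=
  (L.rho X).toDerivation.leibniz f g

theorem br_mulSection (f : SmoothFun m M) (X Y : Cₛ^∞⟮𝓡 m; F, E⟯) :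
    L.br X (mulSection f Y) = mulSection (L.act X f) Y + mulSection f (L.br X Y) := by
  ext x
  exact L.leibniz X Y f x

/-- The function `ρ([X, Y]) f` is given by the commutator of `ρ(X)` and `ρ(Y)`. -/
theorem act_br [T2Space M] [FiniteDimensional ℝ F] [ContMDiffVectorBundle ∞ F E (𝓡 m)]
    (X Y : Cₛ^∞⟮𝓡 m; F, E⟯) (f : SmoothFun m M) :
    L.act (L.br X Y) f = L.act X (L.act Y f) - L.act Y (L.act X f) := by
  have key : ∀ (Z : Cₛ^∞⟮𝓡 m; F, E⟯) x,
      (L.act (L.br X Y) f x - (L.act X (L.act Y f) x - L.act Y (L.act X f) x)) • Z x = 0 := by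
    intro Z x
    have hj : ∀ W, L.br X (L.br Y W) = L.br (L.br X Y) W + L.br Y (L.br X W) := L.jacobi X Y
    have hadd : ∀ U V W, L.br U (V + W) = L.br U V + L.br U W := fun U ↦ map_add (L.bracket U)
    -- In the Jacobi identity for `X`, `Y`, `fZ`, expanded by the Leibniz rule, all that survives is
    -- the difference of the two sides of the claim times `Z`.
    have h := DFunLike.congr_fun (hj (mulSection f Z)) x
    simp only [br_mulSection, hadd] at h
    have hZ := DFunLike.congr_fun (hj Z) x
    simp only [ContMDiffSection.coe_add, Pi.add_apply, mulSection_apply] at h hZ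
    rw [hZ] at h
    rw [← neg_eq_zero, ← sub_eq_zero.2 h]
    module
  ext x
  by_contra hne
  -- A nonzero difference at `x` would force the fibre there to vanish; but then the anchor is zero
  -- at `x` and both sides are zero after all.
  have hzero : ∀ v : E x, v = 0 := by
    intro v
    obtain ⟨Z, rfl⟩ := exists_section_apply_eq (m := m) F x v
    exact (smul_eq_zero.1 (key Z x)).resolve_left (sub_ne_zero.2 hne)
  have hact : ∀ (W : Cₛ^∞⟮𝓡 m; F, E⟯) (g : SmoothFun m M), L.act W g x = 0 := by
    intro W g
    change mfderiv (𝓡 m) 𝓘(ℝ, ℝ) g x (L.anchor x (W x)) = 0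
    rw [hzero (W x), map_zero, map_zero]
  apply hne
  change _ = L.act X (L.act Y f) x - L.act Y (L.act X f) x
  simp only [hact, sub_zero]

end LieAlgebroid

/-- The Lie bracket of vector fields is odd in its first argument. -/
theorem VectorFields.bracket_neg_left (X Y : VectorFields m M) :
    VectorFields.bracket (-X) Y = -VectorFields.bracket X Y := by
  have : IsManifold (𝓡 m) (minSmoothness ℝ 2) M := by
    rw [minSmoothness_of_isRCLikeNormedField]
    exact IsManifold.of_le (n := ∞) (WithTop.coe_le_coe.2 le_top)
  ext x : 1
  have h := mlieBracket_const_smul_left (I := 𝓡 m) (c := (-1 : ℝ)) (W := Y)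
    ((X.contMDiff x).mdifferentiableAt (by simp))
  rw [neg_one_smul, neg_one_smul] at h
  exact h

end Algebroid

/-! ### The bialgebroid condition in its lowest degrees -/

section Bialgebroid

variable {m : ℕ} {M : Type*} [TopologicalSpace M] [ChartedSpace (EuclideanSpace ℝ (Fin m)) M]
  [IsManifold (𝓡 m) ∞ M] [T2Space M]
  {F : Type*} [NormedAddCommGroup F] [NormedSpace ℝ F] [FiniteDimensional ℝ F]
  {A : M → Type*} [∀ x, AddCommGroup (A x)] [∀ x, Module ℝ (A x)] [∀ x, TopologicalSpace (A x)]
  [TopologicalSpace (TotalSpace F A)] [FiberBundle F A] [VectorBundle ℝ F A]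
  [ContMDiffVectorBundle ∞ F A (𝓡 m)]

/-- The differential of a function with respect to a Lie algebroid structure on `A`. -/
theorem LieAlgebroid.exists_differential (L : LieAlgebroid m F A) (f : SmoothFun m M) :
    ∃ θ : Cₛ^∞⟮𝓡 m; F →L[ℝ] ℝ, fun x ↦ A x →L[ℝ] ℝ⟯, ∀ X, pairing θ X = L.act X f := by
  obtain ⟨θ, hθ⟩ := exists_dualSection_of_smooth (m := m) (F := F) (E := A)
    (fun x ↦ ((mfderiv (𝓡 m) 𝓘(ℝ, ℝ) f x).comp (L.anchor x)).toLinearMap)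
    fun X ↦ (L.act X f).contMDiff
  exact ⟨θ, fun X ↦ by ext x; exact hθ x (X x)⟩

variable (L : LieAlgebroid m F A) (L' : LieAlgebroid m (F →L[ℝ] ℝ) fun x ↦ A x →L[ℝ] ℝ)

/-- The differential of a function with respect to a Lie algebroid structure on `A*`. -/
theorem LieAlgebroid.exists_dual_differential (f : SmoothFun m M) :
    ∃ u : Cₛ^∞⟮𝓡 m; F, A⟯, ∀ η, pairing η u = L'.act η f :=
  exists_pairing_eq (fun η ↦ L'.act η f) (fun θ η ↦ L'.act_add_left θ η f)
    fun g θ ↦ L'.act_mulSection g θ f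

theorem sharp_pairing_eq {p : ℕ}
    {P : (Fin (p + 1) → Cₛ^∞⟮𝓡 m; F →L[ℝ] ℝ, fun x ↦ A x →L[ℝ] ℝ⟯) → SmoothFun m M}
    {θ : Fin p → Cₛ^∞⟮𝓡 m; F →L[ℝ] ℝ, fun x ↦ A x →L[ℝ] ℝ⟯} {X : Cₛ^∞⟮𝓡 m; F, A⟯}
    (h : ∀ η, pairing η X = P (Fin.cons η θ)) : Cochain.sharp pairing P θ = X :=
  Cochain.representer_eq h fun _ ↦ section_ext_of_pairing

variable {L L'}

/-- The bialgebroid condition on two functions. -/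
theorem IsLieBialgebroid.act_dual_differential_skew (h : IsLieBialgebroid L L')
    {f g : SmoothFun m M} {u v : Cₛ^∞⟮𝓡 m; F, A⟯}
    (hu : ∀ η, pairing η u = L'.act η f) (hv : ∀ η, pairing η v = L'.act η g) :
    L.act u g = -L.act v f := by
  have h0 := congrFun (h.zero_zero (FormField.ofFun _ _ f) (FormField.ofFun _ _ g)) fun i ↦ i.elim0
  simp only [Cochain.schouten, Pi.sub_apply, Pi.smul_apply, Pi.neg_apply, Pi.zero_apply] at h0
  rw [Cochain.derivTerm_apply_of_subsingleton _ _ rfl rfl,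
    Cochain.derivTerm_apply_of_subsingleton _ _ rfl rfl,
    sharp_pairing_eq (X := u), sharp_pairing_eq (X := v)] at h0
  · simpa [sub_eq_zero, add_eq_zero_iff_eq_neg] using h0
  · intro η
    rw [hv, Cochain.d_zero_apply]
    rfl
  · intro η
    rw [hu, Cochain.d_zero_apply]
    rfl

/-- The bialgebroid condition on a function and a section: `[d⁎f, X] = -L_{df} X`. -/
theorem IsLieBialgebroid.pairing_br_dual_differential (h : IsLieBialgebroid L L')
    {f : SmoothFun m M} {u : Cₛ^∞⟮𝓡 m; F, A⟯} {θ : Cₛ^∞⟮𝓡 m; F →L[ℝ] ℝ, fun x ↦ A x →L[ℝ] ℝ⟯}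
    (hu : ∀ η, pairing η u = L'.act η f) (hθ : ∀ X, pairing θ X = L.act X f)
    (X : Cₛ^∞⟮𝓡 m; F, A⟯) (η : Cₛ^∞⟮𝓡 m; F →L[ℝ] ℝ, fun x ↦ A x →L[ℝ] ℝ⟯) :
    pairing η (L.br u X) = pairing (L'.br θ η) X - L'.act θ (pairing η X) := by
  -- `W` is the contraction `(d⁎X)(·, η)`. It enters through `[f, d⁎X]`, whose value at `η` is
  -- `-ρ(W)f`.
  obtain ⟨W, hW⟩ := exists_pairing_eq (m := m) (E := A)
    (fun ζ ↦ L'.act ζ (pairing η X) - L'.act η (pairing ζ X) - pairing (L'.br ζ η) X)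
    (fun ζ ζ' ↦ by
      simp only [L'.act_add_left, pairing_add_left, L'.act_add, L'.br_add_left]
      ring)
    fun g ζ ↦ by
      simp only [L'.act_mulSection, pairing_mulSection_left, L'.act_mul, L'.br_neg_swap _ η,
        L'.br_mulSection, pairing_neg_left, pairing_add_left]
      ring
  -- The rule `d⁎[f, X] = [d⁎f, X] - [f, d⁎X]`, evaluated on `η`.
  have h0 := congrFun (h.derivation 0 1 0 rfl (FormField.ofFun _ _ f) (FormField.ofSection X))
    fun _ ↦ η
  rw [Cochain.d_zero_apply] at h0
  simp only [Cochain.schouten, Pi.sub_apply, Pi.smul_apply, Pi.neg_apply, Pi.add_apply] at h0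
  have hsX : ∀ θ : Fin 0 → _, Cochain.sharp pairing (FormField.ofSection X).eval θ = X :=
    fun θ ↦ sharp_pairing_eq fun η ↦ rfl
  have hsu : ∀ θ : Fin 0 → _, Cochain.sharp pairing
      (Cochain.d L'.act L'.br (FormField.ofFun (F →L[ℝ] ℝ) (fun x ↦ A x →L[ℝ] ℝ) f).eval) θ = u :=
    fun θ ↦ sharp_pairing_eq fun η ↦ by
      rw [hu, Cochain.d_zero_apply]
      rfl
  have hsW : Cochain.sharp pairing
      (Cochain.d L'.act L'.br (FormField.ofSection X).eval) (fun _ : Fin 1 ↦ η) = W :=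
    sharp_pairing_eq fun ζ ↦ by
      rw [hW, Cochain.d_one_apply]
      rfl
  have : Subsingleton (Equiv.Perm (Fin (0 + 1))) :=
    inferInstanceAs (Subsingleton (Equiv.Perm (Fin 1)))
  have hsl : ∀ k, k = 0 → Cochain.slice (fun _ : Fin 1 ↦ η) k 1 = fun _ ↦ η := by
    rintro _ rfl
    funext i
    fin_cases i
    rfl
  rw [Cochain.derivTerm_apply_of_subsingleton _ _ rfl rfl,
    Cochain.derivTerm_apply_of_subsingleton _ _ rfl rfl,
    Cochain.derivTerm_apply_of_subsingleton _ _ rfl rfl,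
    Cochain.derivTerm_apply_of_subsingleton _ _ rfl rfl,
    Cochain.contractTerm_apply_of_subsingleton _ _ _ rfl rfl, hsX, hsX, hsu, hsu,
    hsl _ rfl, hsW] at h0
  rw [Cochain.d_zero_apply] at h0
  simp only [FormField.ofFun_eval, FormField.ofSection_eval, hsX, Cochain.dTwo,
    show Cochain.entry (fun _ : Fin 1 ↦ η) 0 = η from rfl, zero_mul, pow_zero, zero_add, pow_one,
    smul_eq_mul, one_mul, neg_mul, neg_neg, L'.act_neg, hu] at h0
  -- Here `ρ(W)f = ⟨θ, W⟩ = (d⁎X)(θ, η)`; its middle term cancels the value of `d⁎[f, X]` on `η`.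
  have hWf : L.act W f = L'.act θ (pairing η X) - L'.act η (L.act X f) - pairing (L'.br θ η) X := by
    rw [← hθ, hW, hθ]
  rw [hWf] at h0
  linear_combination -h0

end Bialgebroid

/-! ### Derivatives of determinants -/

section Determinant

open Matrix

variable {R ι : Type*} [CommRing R] [DecidableEq ι]

theorem Derivation.map_prod [Algebra ℝ R] (D : Derivation ℝ R R) (s : Finset ι) (a : ι → R) :
    D (∏ i ∈ s, a i) = ∑ i ∈ s, D (a i) * ∏ j ∈ s.erase i, a j := by
  induction s using Finset.induction_on with
  | empty => simp
  | insert i s hi ih =>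
    rw [Finset.prod_insert hi, D.leibniz, ih, Finset.sum_insert hi, Finset.erase_insert hi,
      smul_eq_mul, smul_eq_mul, add_comm, mul_comm, Finset.mul_sum]
    congr 1
    refine Finset.sum_congr rfl fun j hj ↦ ?_
    have hij : i ≠ j := fun h ↦ hi (h ▸ hj)
    rw [Finset.erase_insert_of_ne hij, Finset.prod_insert (by simp [hi])]
    ring

variable [Fintype ι]

theorem Derivation.map_det [Algebra ℝ R] (D : Derivation ℝ R R) (B : Matrix ι ι R) :
    D B.det = ∑ j, (B.updateCol j fun i ↦ D (B i j)).det := by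
  simp only [Matrix.det_apply', map_sum, D.leibniz, Derivation.map_intCast, smul_zero, add_zero]
  rw [Finset.sum_comm]
  refine Finset.sum_congr rfl fun σ _ ↦ ?_
  rw [← Finset.mul_sum, smul_eq_mul, Derivation.map_prod]
  congr 1
  refine Finset.sum_congr rfl fun j _ ↦ ?_
  rw [← Finset.mul_prod_erase _ _ (Finset.mem_univ j), Matrix.updateCol_self]
  congr 1
  refine Finset.prod_congr rfl fun i hi ↦ ?_
  rw [Matrix.updateCol_ne (Finset.ne_of_mem_erase hi)]

/-- By Cramer's rule the `j`-th determinant is the `j`-th diagonal entry of `adj(B) P`. The row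
version yields the same trace, so row and column replacements may be exchanged inside such sums. -/
theorem Matrix.sum_det_updateCol_eq_trace (B P : Matrix ι ι R) :
    ∑ j, (B.updateCol j fun i ↦ P i j).det = (B.adjugate * P).trace := by
  refine Finset.sum_congr rfl fun j _ ↦ ?_
  rw [← Matrix.cramer_apply, Matrix.cramer_eq_adjugate_mulVec]
  rfl

theorem Matrix.sum_det_updateRow_eq_trace (B P : Matrix ι ι R) :
    ∑ i, (B.updateRow i (P i)).det = (B.adjugate * P).trace := by
  rw [← Matrix.trace_transpose, Matrix.transpose_mul, Matrix.trace_mul_comm,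
    Matrix.adjugate_transpose, ← Matrix.sum_det_updateCol_eq_trace]
  refine Finset.sum_congr rfl fun i _ ↦ ?_
  rw [← Matrix.det_transpose, ← Matrix.updateCol_transpose]
  rfl

/-- Jacobi's formula `D det B = tr(adj(B) DB)` is linear in `DB`. One summand can thus be spread
over rows and the other over columns, which suits a matrix `⟨ηᵢ, Xⱼ⟩` whose derivative acts
separately on the `ηᵢ` and the `Xⱼ`. -/
theorem Derivation.map_det_of_add [Algebra ℝ R] (D : Derivation ℝ R R) {B P Q : Matrix ι ι R}
    (h : ∀ i j, D (B i j) = P i j + Q i j) :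
    D B.det = ∑ i, (B.updateRow i (P i)).det + ∑ j, (B.updateCol j fun i ↦ Q i j).det := by
  rw [D.map_det, Matrix.sum_det_updateCol_eq_trace B Q, Matrix.sum_det_updateRow_eq_trace,
    ← Matrix.trace_add, ← Matrix.mul_add, ← Matrix.sum_det_updateCol_eq_trace]
  simp [h]

end Determinant

/-! ### Top-degree forms and dual volumes -/

section Volume

variable {m : ℕ} {M : Type*} [TopologicalSpace M] [ChartedSpace (EuclideanSpace ℝ (Fin m)) M]
  {F : Type*} [NormedAddCommGroup F] [NormedSpace ℝ F]
  {A : M → Type*} [∀ x, AddCommGroup (A x)] [∀ x, Module ℝ (A x)] [∀ x, TopologicalSpace (A x)]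
  [TopologicalSpace (TotalSpace F A)] [FiberBundle F A]

theorem FormField.eval_update_neg {k : ℕ} (w : FormField m F A k) [VectorBundle ℝ F A]
    (Y : Fin k → Cₛ^∞⟮𝓡 m; F, A⟯) (i : Fin k) (Z : Cₛ^∞⟮𝓡 m; F, A⟯) :
    w.eval (Function.update Y i (-Z)) = -w.eval (Function.update Y i Z) := by
  have h : ∀ (W : Cₛ^∞⟮𝓡 m; F, A⟯) x, (fun j ↦ Function.update Y i W j x) =
      Function.update (fun j ↦ Y j x) i (W x) := fun W x ↦
    Function.comp_update (fun Z : Cₛ^∞⟮𝓡 m; F, A⟯ ↦ Z x) Y i W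
  ext x
  change w.toFun x (fun j ↦ Function.update Y i (-Z) j x) =
    -w.toFun x (fun j ↦ Function.update Y i Z j x)
  rw [h, h, ← AlternatingMap.map_update_neg]
  rfl

variable [VectorBundle ℝ F A]

theorem IsDualVolume.eval_mul_eval {n : ℕ} {Ω : FormField m F A n}
    {V : FormField m (F →L[ℝ] ℝ) (fun x ↦ A x →L[ℝ] ℝ) n} (h : IsDualVolume Ω V)
    (X : Fin n → Cₛ^∞⟮𝓡 m; F, A⟯) (θ : Fin n → Cₛ^∞⟮𝓡 m; F →L[ℝ] ℝ, fun x ↦ A x →L[ℝ] ℝ⟯) :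
    Ω.eval X * V.eval θ = (Matrix.of fun i j ↦ pairing (θ i) (X j)).det := by
  ext x
  refine (h x (fun i ↦ X i x) fun i ↦ θ i x).trans ?_
  exact (RingHom.map_det ((Pi.evalRingHom (fun _ : M ↦ ℝ) x).comp
    (ContMDiffMap.coeFnRingHom : SmoothFun m M →+* M → ℝ))
      (Matrix.of fun i j ↦ pairing (θ i) (X j))).symm

theorem lieForm_neg [IsManifold (𝓡 m) ∞ M] (Z : VectorFields m M)
    (s : FormField m (EuclideanSpace ℝ (Fin m)) (fun x : M ↦ TangentSpace (𝓡 m) x) m)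
    (Y : Fin m → VectorFields m M) :
    Cochain.lieForm VectorFields.act VectorFields.bracket (-Z) s.eval Y =
      -Cochain.lieForm VectorFields.act VectorFields.bracket Z s.eval Y := by
  have h : (-Z).act (s.eval Y) = -Z.act (s.eval Y) := by
    ext x
    exact map_neg (mfderiv (𝓡 m) 𝓘(ℝ, ℝ) (s.eval Y) x) (Z x)
  simp only [Cochain.lieForm, h, VectorFields.bracket_neg_left, FormField.eval_update_neg,
    Finset.sum_neg_distrib]
  ring

end Volume

/-! ### Exact sections and their action on dual volumes -/

section Modular

variable {m n : ℕ} {M : Type*} [TopologicalSpace M] [ChartedSpace (EuclideanSpace ℝ (Fin m)) M]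
  [IsManifold (𝓡 m) ∞ M] [T2Space M]
  {F : Type*} [NormedAddCommGroup F] [NormedSpace ℝ F] [FiniteDimensional ℝ F]
  {A : M → Type*} [∀ x, AddCommGroup (A x)] [∀ x, Module ℝ (A x)] [∀ x, TopologicalSpace (A x)]
  [TopologicalSpace (TotalSpace F A)] [FiberBundle F A] [VectorBundle ℝ F A]
  [ContMDiffVectorBundle ∞ F A (𝓡 m)]
  {L : LieAlgebroid m F A} {L' : LieAlgebroid m (F →L[ℝ] ℝ) fun x ↦ A x →L[ℝ] ℝ}
  {f g : SmoothFun m M} {u v : Cₛ^∞⟮𝓡 m; F, A⟯}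
  {θ : Cₛ^∞⟮𝓡 m; F →L[ℝ] ℝ, fun x ↦ A x →L[ℝ] ℝ⟯}

namespace IsLieBialgebroid

/-- Both sides are read off from `d⁎g`: `ρ⁎(df)g = ⟨df, d⁎g⟩ = ρ(d⁎g)f`, and skew-symmetry exchanges
`f` and `g`. -/
theorem act_differential (h : IsLieBialgebroid L L')
    (hu : ∀ η, pairing η u = L'.act η f) (hθ : ∀ X, pairing θ X = L.act X f) (g : SmoothFun m M) :
    L'.act θ g = -L.act u g := by
  obtain ⟨v, hv⟩ := L'.exists_dual_differential g
  rw [← hv, hθ, h.act_dual_differential_skew hv hu]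

theorem rho_differential (h : IsLieBialgebroid L L')
    (hu : ∀ η, pairing η u = L'.act η f) (hθ : ∀ X, pairing θ X = L.act X f) :
    L'.rho θ = -L.rho u := by
  refine VectorFields.ext_of_act fun g ↦ ?_
  refine (h.act_differential hu hθ g).trans ?_
  ext x
  exact (map_neg (mfderiv (𝓡 m) 𝓘(ℝ, ℝ) g x) (L.rho u x)).symm

/-- The bracket of two exact sections of `A` is exact: `[d⁎f, d⁎g] = d⁎{f, g}`. -/
theorem pairing_br_dual_differentials (h : IsLieBialgebroid L L')
    (hu : ∀ η, pairing η u = L'.act η f) (hv : ∀ η, pairing η v = L'.act η g)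
    (η : Cₛ^∞⟮𝓡 m; F →L[ℝ] ℝ, fun x ↦ A x →L[ℝ] ℝ⟯) :
    pairing η (L.br u v) = L'.act η (L.act u g) := by
  obtain ⟨θ, hθ⟩ := L.exists_differential f
  rw [h.pairing_br_dual_differential hu hθ, hv, hv, L'.act_br, h.act_differential hu hθ g,
    L'.act_neg]
  ring

/-- Together with `lieDual_differential`, this trades Lie derivatives along `d⁎f` and `df` for
brackets in the opposite algebroid, so that both `L_u V` and `L_θ Ω` are expressed by the same terms
`[θ, ηᵢ]` and `[u, Xⱼ]`. -/
theorem lieDual_dual_differential (h : IsLieBialgebroid L L')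
    (hu : ∀ η, pairing η u = L'.act η f) (hθ : ∀ X, pairing θ X = L.act X f)
    (η : Cₛ^∞⟮𝓡 m; F →L[ℝ] ℝ, fun x ↦ A x →L[ℝ] ℝ⟯) :
    Cochain.lieDual L.act L.br pairing u η = -L'.br θ η :=
  Cochain.representer_eq (fun Y ↦ by
    rw [pairing_neg_left, h.pairing_br_dual_differential hu hθ, h.act_differential hu hθ]
    ring) fun _ ↦ dualSection_ext_of_pairing

theorem lieDual_differential (h : IsLieBialgebroid L L')
    (hu : ∀ η, pairing η u = L'.act η f) (hθ : ∀ X, pairing θ X = L.act X f)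
    (X : Cₛ^∞⟮𝓡 m; F, A⟯) :
    Cochain.lieDual L'.act L'.br pairing' θ X = -L.br u X :=
  Cochain.representer_eq (fun η ↦ by
    change pairing η (-L.br u X) = L'.act θ (pairing η X) - pairing (L'.br θ η) X
    rw [pairing_neg_right, h.pairing_br_dual_differential hu hθ]
    ring) fun _ ↦ section_ext_of_pairing

/-- For dual volumes, `(L_{d⁎f} V) / V = (L_{df} Ω) / Ω`. -/
theorem lieMulti_dual_differential (h : IsLieBialgebroid L L')
    (hu : ∀ η, pairing η u = L'.act η f) (hθ : ∀ X, pairing θ X = L.act X f)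
    {Ω : FormField m F A n} {V : FormField m (F →L[ℝ] ℝ) (fun x ↦ A x →L[ℝ] ℝ) n}
    (hΩV : IsDualVolume Ω V) (X : Fin n → Cₛ^∞⟮𝓡 m; F, A⟯)
    (η : Fin n → Cₛ^∞⟮𝓡 m; F →L[ℝ] ℝ, fun x ↦ A x →L[ℝ] ℝ⟯) :
    Ω.eval X * Cochain.lieMulti L.act L.br pairing u V.eval η =
      V.eval η * Cochain.lieMulti L'.act L'.br pairing' θ Ω.eval X := by
  simp only [Cochain.lieMulti, h.lieDual_dual_differential hu hθ, h.lieDual_differential hu hθ,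
    FormField.eval_update_neg, h.act_differential hu hθ, Finset.sum_neg_distrib]
  -- The entries satisfy `ρ(u)⟨ηᵢ, Xⱼ⟩ = -⟨[θ, ηᵢ], Xⱼ⟩ + ⟨ηᵢ, [u, Xⱼ]⟩`: the first term changes a
  -- row, hence an argument of `V`, and the second a column, hence an argument of `Ω`.
  have hdet := (L.rho u).toDerivation.map_det_of_add
    (B := Matrix.of fun i j ↦ pairing (η i) (X j))
    (P := Matrix.of fun i j ↦ -pairing (L'.br θ (η i)) (X j))
    (Q := Matrix.of fun i j ↦ pairing (η i) (L.br u (X j))) fun i j ↦ by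
      change L.act u (pairing (η i) (X j)) =
        -pairing (L'.br θ (η i)) (X j) + pairing (η i) (L.br u (X j))
      rw [h.pairing_br_dual_differential hu hθ, h.act_differential hu hθ]
      ring
  have hrow : ∀ i, ((Matrix.of fun i j ↦ pairing (η i) (X j)).updateRow i
      ((Matrix.of fun i j ↦ -pairing (L'.br θ (η i)) (X j)) i)).det =
      -(Ω.eval X * V.eval (Function.update η i (L'.br θ (η i)))) := fun i ↦ by
    rw [← mul_neg, ← FormField.eval_update_neg, hΩV.eval_mul_eval]
    congr 1
    ext1 k j
    by_cases hk : k = i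
    · subst hk
      simp [pairing_neg_left]
    · simp [hk]
  have hcol : ∀ j, ((Matrix.of fun i j ↦ pairing (η i) (X j)).updateCol j fun i ↦
      (Matrix.of fun i j ↦ pairing (η i) (L.br u (X j))) i j).det =
      Ω.eval (Function.update X j (L.br u (X j))) * V.eval η := fun j ↦ by
    rw [hΩV.eval_mul_eval]
    congr 1
    ext1 i k
    by_cases hk : k = j
    · subst hk
      simp
    · simp [hk]
  simp only [hrow, hcol] at hdet
  rw [← hΩV.eval_mul_eval, Derivation.leibniz, Finset.sum_neg_distrib, ← Finset.mul_sum,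
    ← Finset.sum_mul] at hdet
  simp only [← L.act_eq_toDerivation, smul_eq_mul] at hdet
  linear_combination hdet

end IsLieBialgebroid

/-- At every point there are sections on which dual volumes do not vanish. -/
theorem IsDualVolume.exists_eval_mul_eval_ne_zero
    {A : M → Type*} [∀ x, AddCommGroup (A x)] [∀ x, Module ℝ (A x)] [∀ x, TopologicalSpace (A x)]
    [TopologicalSpace (TotalSpace (EuclideanSpace ℝ (Fin n)) A)]
    [FiberBundle (EuclideanSpace ℝ (Fin n)) A] [VectorBundle ℝ (EuclideanSpace ℝ (Fin n)) A]
    [ContMDiffVectorBundle ∞ (EuclideanSpace ℝ (Fin n)) A (𝓡 m)]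
    {Ω : FormField m (EuclideanSpace ℝ (Fin n)) A n}
    {V : FormField m (EuclideanSpace ℝ (Fin n) →L[ℝ] ℝ) (fun x ↦ A x →L[ℝ] ℝ) n}
    (hΩV : IsDualVolume Ω V) (x : M) :
    ∃ (X : Fin n → Cₛ^∞⟮𝓡 m; EuclideanSpace ℝ (Fin n), A⟯)
      (η : Fin n → Cₛ^∞⟮𝓡 m; EuclideanSpace ℝ (Fin n) →L[ℝ] ℝ, fun x ↦ A x →L[ℝ] ℝ⟯),
      (Ω.eval X * V.eval η) x ≠ 0 := by
  let Φ := VectorBundle.continuousLinearEquivAt ℝ (EuclideanSpace ℝ (Fin n)) A x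
  -- Dual bases of the fibre at `x` make the pairing matrix the identity there, so `Ω(X)V(η)` equals
  -- `1` at `x`.
  choose X hX using fun i ↦ exists_section_apply_eq (m := m) (EuclideanSpace ℝ (Fin n)) x
    (Φ.symm (EuclideanSpace.single i 1))
  choose η hη using fun i ↦ exists_dualSection_apply_eq (m := m) (EuclideanSpace ℝ (Fin n)) x
    ((EuclideanSpace.proj i : EuclideanSpace ℝ (Fin n) →L[ℝ] ℝ).comp
      (Φ : A x →L[ℝ] EuclideanSpace ℝ (Fin n)))
  refine ⟨X, η, ?_⟩
  have h1 := hΩV x (fun i ↦ X i x) fun i ↦ η i x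
  have h2 : (Matrix.of fun i j ↦ η i x (X j x)) = 1 := by
    ext i j
    simp [hX, hη, Matrix.one_apply]
  rw [h2, Matrix.det_one] at h1
  change Ω.toFun x (fun i ↦ X i x) * V.toFun x (fun i ↦ η i x) ≠ 0
  rw [h1]
  exact one_ne_zero

end Modular

/-! ### The Poisson bivector -/

section PoissonStructure

variable {m : ℕ} {M : Type*} [TopologicalSpace M] [ChartedSpace (EuclideanSpace ℝ (Fin m)) M]
  [IsManifold (𝓡 m) ∞ M]
  {F : Type*} [NormedAddCommGroup F] [NormedSpace ℝ F]
  {A : M → Type*} [∀ x, AddCommGroup (A x)] [∀ x, Module ℝ (A x)] [∀ x, TopologicalSpace (A x)]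
  [TopologicalSpace (TotalSpace F A)] [FiberBundle F A] [VectorBundle ℝ F A]
  {L : LieAlgebroid m F A} {L' : LieAlgebroid m (F →L[ℝ] ℝ) fun x ↦ A x →L[ℝ] ℝ}
  {f : SmoothFun m M} {u : Cₛ^∞⟮𝓡 m; F, A⟯}

theorem anchorTranspose_eq_of_forall {x : M} {α : TangentSpace (𝓡 m) x →L[ℝ] ℝ} {a : A x}
    (h : ∀ φ : A x →L[ℝ] ℝ, φ a = α (L'.anchor x φ)) : L'.anchorTranspose x α = a :=
  Cochain.representer_eq h fun _ ↦ dual_separates F x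

variable [T2Space M] [FiniteDimensional ℝ F] [ContMDiffVectorBundle ∞ F A (𝓡 m)]

theorem anchorTranspose_differential (hu : ∀ η, pairing η u = L'.act η f) (x : M) :
    L'.anchorTranspose x (differential f x) = u x := by
  refine anchorTranspose_eq_of_forall fun φ ↦ ?_
  obtain ⟨η, rfl⟩ := exists_dualSection_apply_eq (m := m) F x φ
  exact DFunLike.congr_fun (hu η) x

/-- This shows that the choice in `anchorTranspose` always succeeds: every covector at `x` is some
`df`, and then `d⁎f` provides the vector. -/
theorem apply_anchorTranspose (x : M) (α : TangentSpace (𝓡 m) x →L[ℝ] ℝ) (φ : A x →L[ℝ] ℝ) :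
    φ (L'.anchorTranspose x α) = α (L'.anchor x φ) := by
  obtain ⟨f, rfl⟩ := exists_differential_eq x α
  obtain ⟨u, hu⟩ := L'.exists_dual_differential f
  obtain ⟨η, rfl⟩ := exists_dualSection_apply_eq (m := m) F x φ
  rw [anchorTranspose_differential hu]
  exact DFunLike.congr_fun (hu η) x

variable (L L') in
/-- The bundle map `ρ ∘ (ρ⁎)* : T*M → TM` on a fibre, as a linear map. -/
noncomputable def anchorCompTransposeLinear (x : M) :
    (TangentSpace (𝓡 m) x →L[ℝ] ℝ) →ₗ[ℝ] TangentSpace (𝓡 m) x where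
  toFun α := L.anchor x (L'.anchorTranspose x α)
  map_add' α β := by
    rw [anchorTranspose_eq_of_forall (F := F)
      (a := L'.anchorTranspose x α + L'.anchorTranspose x β)]
    · exact map_add _ _ _
    · intro φ
      rw [map_add, apply_anchorTranspose, apply_anchorTranspose]
      rfl
  map_smul' c α := by
    rw [anchorTranspose_eq_of_forall (F := F) (a := c • L'.anchorTranspose x α)]
    · exact map_smul _ _ _
    · intro φ
      rw [map_smul, apply_anchorTranspose]
      rfl

variable (L L') in
/-- The bundle map `ρ ∘ (ρ⁎)* : T*M → TM` on a fibre. -/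
noncomputable def anchorCompTranspose (x : M) :
    (TangentSpace (𝓡 m) x →L[ℝ] ℝ) →L[ℝ] TangentSpace (𝓡 m) x :=
  ⟨anchorCompTransposeLinear L L' x, LinearMap.continuous_of_fiber
    (E := fun x : M ↦ TangentSpace (𝓡 m) x →L[ℝ] ℝ) (EuclideanSpace ℝ (Fin m) →L[ℝ] ℝ) _⟩

theorem exists_section_eq_anchorTranspose (α : OneForms m M) :
    ∃ W : Cₛ^∞⟮𝓡 m; F, A⟯, ∀ x, W x = L'.anchorTranspose x (α x) := by
  obtain ⟨W, hW⟩ := exists_pairing_eq (m := m) (E := A)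
    (fun η ↦ pairing (E := fun x : M ↦ TangentSpace (𝓡 m) x) α (L'.rho η))
    (fun η ζ ↦ by
      ext x
      change α x (L'.anchor x (η x + ζ x)) = _
      rw [map_add, map_add]
      rfl)
    fun g η ↦ by
      ext x
      change α x (L'.anchor x (g x • η x)) = _
      rw [map_smul, map_smul]
      rfl
  refine ⟨W, fun x ↦ (anchorTranspose_eq_of_forall fun φ ↦ ?_).symm⟩
  obtain ⟨η, rfl⟩ := exists_dualSection_apply_eq (m := m) F x φ
  exact DFunLike.congr_fun (hW η) x

/-- The bivector field of a Lie bialgebroid. -/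
noncomputable def IsLieBialgebroid.bivector (h : IsLieBialgebroid L L') : BivectorField m M where
  sharp := ⟨anchorCompTranspose L L', by
    refine contMDiff_hom_of_apply (F := EuclideanSpace ℝ (Fin m) →L[ℝ] ℝ)
      (E := fun x : M ↦ TangentSpace (𝓡 m) x →L[ℝ] ℝ) (F' := EuclideanSpace ℝ (Fin m))
      (E' := fun x : M ↦ TangentSpace (𝓡 m) x) (anchorCompTranspose L L') fun α ↦ ?_
    obtain ⟨W, hW⟩ := exists_section_eq_anchorTranspose (L' := L') α
    refine (L.rho W).contMDiff.congr fun x ↦ ?_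
    change TotalSpace.mk' _ x (L.anchor x (L'.anchorTranspose x (α x))) = _
    rw [← hW]
    rfl⟩
  skew := fun x α β ↦ by
    -- Skew-symmetry is pointwise, so it suffices to test it on differentials, where it is the
    -- bialgebroid condition on two functions.
    obtain ⟨f, rfl⟩ := exists_differential_eq x α
    obtain ⟨g, rfl⟩ := exists_differential_eq x β
    obtain ⟨u, hu⟩ := L'.exists_dual_differential f
    obtain ⟨v, hv⟩ := L'.exists_dual_differential g
    change differential g x (L.anchor x (L'.anchorTranspose x (differential f x))) =
      -differential f x (L.anchor x (L'.anchorTranspose x (differential g x)))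
    rw [anchorTranspose_differential hu, anchorTranspose_differential hv]
    exact DFunLike.congr_fun (h.act_dual_differential_skew hu hv) x

namespace IsLieBialgebroid

theorem bivector_ham (h : IsLieBialgebroid L L') (hu : ∀ η, pairing η u = L'.act η f) :
    h.bivector.ham f = L.rho u := by
  ext x : 1
  change L.anchor x (L'.anchorTranspose x (differential f x)) = L.anchor x (u x)
  rw [anchorTranspose_differential hu]

theorem bivector_poissonBracket (h : IsLieBialgebroid L L')
    (hu : ∀ η, pairing η u = L'.act η f) (g : SmoothFun m M) :
    h.bivector.poissonBracket f g = L.act u g := by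
  rw [BivectorField.poissonBracket, h.bivector_ham hu]
  rfl

/-- Since `[d⁎f, d⁎g] = d⁎{f,g}`, the Hamiltonian field of `{f,g}` is `ρ([u, v])`, and the Jacobi
identity becomes `act_br`. -/
theorem bivector_isPoisson (h : IsLieBialgebroid L L') : h.bivector.IsPoisson := by
  intro f g k
  obtain ⟨u, hu⟩ := L'.exists_dual_differential f
  obtain ⟨v, hv⟩ := L'.exists_dual_differential g
  rw [h.bivector_poissonBracket hu g,
    h.bivector_poissonBracket (h.pairing_br_dual_differentials hu hv),
    h.bivector_poissonBracket hv, h.bivector_poissonBracket hv, h.bivector_poissonBracket hu,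
    h.bivector_poissonBracket hu, L.act_br]
  ring

end IsLieBialgebroid

/-- At each point `s` is nonzero on some tuple of vectors; extending these to vector fields allows
division by `s`, and a vector field is determined by its action on functions. -/
theorem BivectorField.IsModularVectorField.eq {P : BivectorField m M}
    {s : FormField m (EuclideanSpace ℝ (Fin m)) (fun x : M ↦ TangentSpace (𝓡 m) x) m}
    (hs : ∀ x, s.toFun x ≠ 0) {Z Z' : VectorFields m M}
    (hZ : P.IsModularVectorField s Z) (hZ' : P.IsModularVectorField s Z') : Z = Z' := by
  refine VectorFields.ext_of_act fun f ↦ ?_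
  ext x
  have hex : ∃ y, s.toFun x y ≠ 0 := by
    by_contra! h0
    exact hs x (AlternatingMap.ext h0)
  obtain ⟨y, hy⟩ := hex
  choose Y hY using fun i ↦ exists_section_apply_eq (m := m)
    (E := fun x : M ↦ TangentSpace (𝓡 m) x) (EuclideanSpace ℝ (Fin m)) x (y i)
  have h1 := DFunLike.congr_fun ((hZ f Y).symm.trans (hZ' f Y)) x
  change Z.act f x * s.toFun x (fun i ↦ Y i x) = Z'.act f x * s.toFun x (fun i ↦ Y i x) at h1
  simp only [hY] at h1
  exact mul_right_cancel₀ hy h1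

end PoissonStructure

/-! ### The modular vector field -/

theorem IsLieBialgebroid.isModularVectorField {m n : ℕ} {M : Type*} [TopologicalSpace M]
    [T2Space M] [ChartedSpace (EuclideanSpace ℝ (Fin m)) M] [IsManifold (𝓡 m) ∞ M]
    {A : M → Type*} [∀ x, AddCommGroup (A x)] [∀ x, Module ℝ (A x)]
    [∀ x, TopologicalSpace (A x)] [TopologicalSpace (TotalSpace (EuclideanSpace ℝ (Fin n)) A)]
    [FiberBundle (EuclideanSpace ℝ (Fin n)) A] [VectorBundle ℝ (EuclideanSpace ℝ (Fin n)) A]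
    [ContMDiffVectorBundle ∞ (EuclideanSpace ℝ (Fin n)) A (𝓡 m)]
    {L : LieAlgebroid m (EuclideanSpace ℝ (Fin n)) A}
    {L' : LieAlgebroid m (EuclideanSpace ℝ (Fin n) →L[ℝ] ℝ) fun x ↦ A x →L[ℝ] ℝ}
    (h : IsLieBialgebroid L L')
    {s : FormField m (EuclideanSpace ℝ (Fin m)) (fun x : M ↦ TangentSpace (𝓡 m) x) m}
    {Ω : FormField m (EuclideanSpace ℝ (Fin n)) A n}
    {V : FormField m (EuclideanSpace ℝ (Fin n) →L[ℝ] ℝ) (fun x ↦ A x →L[ℝ] ℝ) n}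
    (hΩV : IsDualVolume Ω V)
    {X₀ : Cₛ^∞⟮𝓡 m; EuclideanSpace ℝ (Fin n), A⟯} (hX₀ : IsDualModularCocycle L' s Ω X₀)
    {ξ₀ : Cₛ^∞⟮𝓡 m; EuclideanSpace ℝ (Fin n) →L[ℝ] ℝ, fun x ↦ A x →L[ℝ] ℝ⟯}
    (hξ₀ : IsModularCocycle L s V ξ₀) :
    h.bivector.IsModularVectorField s ((1 / 2 : ℝ) • (L'.rho ξ₀ - L.rho X₀)) := by
  intro f Y
  obtain ⟨u, hu⟩ := L'.exists_dual_differential f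
  obtain ⟨θ, hθ⟩ := L.exists_differential f
  rw [h.bivector_ham hu]
  have hact : ((1 / 2 : ℝ) • (L'.rho ξ₀ - L.rho X₀)).act f =
      (1 / 2 : ℝ) • (pairing ξ₀ u - pairing θ X₀) := by
    rw [hu, hθ]
    ext x
    change mfderiv (𝓡 m) 𝓘(ℝ, ℝ) f x ((1 / 2 : ℝ) • (L'.rho ξ₀ x - L.rho X₀ x)) = _
    rw [map_smul, map_sub]
    rfl
  rw [hact]
  ext x
  obtain ⟨X, η, hne⟩ := hΩV.exists_eval_mul_eval_ne_zero x
  have h1 := hξ₀ u Y η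
  have h2 := hX₀ θ X Y
  rw [h.rho_differential hu hθ, lieForm_neg] at h2
  have h3 := h.lieMulti_dual_differential hu hθ hΩV X η
  -- The difference of the two cocycle equations, cleared of denominators: `L_{ρ(u)} s` occurs in
  -- them with opposite signs and is doubled, while `h3` cancels the terms `L_u V` and `L_θ Ω`.
  have key : (1 + 1) * (Ω.eval X * V.eval η) *
      Cochain.lieForm VectorFields.act VectorFields.bracket (L.rho u) s.eval Y =
      (Ω.eval X * V.eval η) * ((pairing ξ₀ u - pairing θ X₀) * s.eval Y) := by
    linear_combination Ω.eval X * h1 - V.eval η * h2 - s.eval Y * h3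
  have hx := DFunLike.congr_fun key x
  set l := Cochain.lieForm VectorFields.act VectorFields.bracket (L.rho u) s.eval Y
  change (1 + 1) * (Ω.eval X * V.eval η) x * l x =
    (Ω.eval X * V.eval η) x * ((pairing ξ₀ u x - pairing θ X₀ x) * s.eval Y x) at hx
  change l x = (1 / 2 : ℝ) * (pairing ξ₀ u x - pairing θ X₀ x) * s.eval Y x
  refine mul_left_cancel₀ hne ?_
  linear_combination (1 / 2 : ℝ) * hx

theorem corollary2p7 {m n : ℕ} {M : Type*} [TopologicalSpace M] [T2Space M]
    [SecondCountableTopology M] [ChartedSpace (EuclideanSpace ℝ (Fin m)) M]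
    [IsManifold (𝓡 m) ∞ M]
    {A : M → Type*} [∀ x, AddCommGroup (A x)] [∀ x, Module ℝ (A x)]
    [∀ x, TopologicalSpace (A x)] [TopologicalSpace (TotalSpace (EuclideanSpace ℝ (Fin n)) A)]
    [FiberBundle (EuclideanSpace ℝ (Fin n)) A] [VectorBundle ℝ (EuclideanSpace ℝ (Fin n)) A]
    [ContMDiffVectorBundle ∞ (EuclideanSpace ℝ (Fin n)) A (𝓡 m)]
    -- a Lie bialgebroid `(A, A*)`
    (L : LieAlgebroid m (EuclideanSpace ℝ (Fin n)) A)
    (L' : LieAlgebroid m (EuclideanSpace ℝ (Fin n) →L[ℝ] ℝ) fun x ↦ A x →L[ℝ] ℝ)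
    (hLL' : IsLieBialgebroid L L')
    -- a volume form `s` on `M`
    (s : FormField m (EuclideanSpace ℝ (Fin m)) (fun x : M ↦ TangentSpace (𝓡 m) x) m)
    (hs : ∀ x, s.toFun x ≠ 0)
    -- a nowhere vanishing section `Ω` of the top exterior power of `A*`, and the dual section `V`
    (Ω : FormField m (EuclideanSpace ℝ (Fin n)) A n) (hΩ : ∀ x, Ω.toFun x ≠ 0)
    (V : FormField m (EuclideanSpace ℝ (Fin n) →L[ℝ] ℝ) (fun x ↦ A x →L[ℝ] ℝ) n)
    (hΩV : IsDualVolume Ω V)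
    -- the modular cocycles `X₀` of `A*` and `ξ₀` of `A`
    (X₀ : Cₛ^∞⟮𝓡 m; EuclideanSpace ℝ (Fin n), A⟯) (hX₀ : IsDualModularCocycle L' s Ω X₀)
    (ξ₀ : Cₛ^∞⟮𝓡 m; EuclideanSpace ℝ (Fin n) →L[ℝ] ℝ, fun x ↦ A x →L[ℝ] ℝ⟯)
    (hξ₀ : IsModularCocycle L s V ξ₀) :
    -- the associated Poisson bivector `π = P`, with `π♯ = ρ ∘ (ρ⁎)*`, and its modular vector field
    ∃ P : BivectorField m M,
      (∀ x α, P.sharp x α = L.anchor x (L'.anchorTranspose x α)) ∧ P.IsPoisson ∧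
        ∀ Z : VectorFields m M,
          P.IsModularVectorField s Z ↔ Z = (1 / 2 : ℝ) • (L'.rho ξ₀ - L.rho X₀) := by
  refine ⟨hLL'.bivector, fun x α ↦ rfl, hLL'.bivector_isPoisson, fun Z ↦ ⟨fun hZ ↦ ?_, ?_⟩⟩
  · exact hZ.eq hs (hLL'.isModularVectorField hΩV hX₀ hξ₀)
  · rintro rfl
    exact hLL'.isModularVectorField hΩV hX₀ hξ₀
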